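/- Let $(A,\mathfrak m)$ be a Noetherian local ring of dimension $d\ge 2$ and positive depth. Let $x\in\mathfrak m$ be a superficial element, i.e. there is an integer $c\ge 0$ such that $(\mathfrak m^{n+1}:x)\cap\mathfrak m^c=\mathfrak m^n$ for all $n\ge c$. Let $$G=\operatorname{gr}_{\mathfrak m}(A)=\bigoplus_{n\ge 0}\mathfrak m^n/\mathfrak m^{n+1},\qquad \overline G=\operatorname{gr}_{\mathfrak m/xA}(A/xA)$$ be the associated graded rings of $A$ and of $A/xA$. For a standard graded algebra $R$ let $\operatorname{reg}(R)=\max\{a_i(R)+i \mid i\ge 0\}$ be its Castelnuovo–Mumford regularity, where $a_i(R)=\max\{n\mid H^i_{R_+}(R)_n\ne 0\}$ (and $a_i(R)=-\infty$ if $H^i_{R_+}(R)=0$), and let $h^1_{\overline G}(t)=\sum_{j=0}^t\lambda(\overline G_j)$, where $\lambda$ denotes length, be the first iterated Hilbert function of $\overline G$. Then $m:=\operatorname{reg}(\overline G)$ is a (finite) non-negative integer and $$\operatorname{reg}(G)\le m+h^1_{\overline G}(m).$$ -/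

import Mathlib

namespace LocalMumford

/-! ## Graded local cohomology through the Čech complex -/

section Cech

variable {R : Type*} [CommRing R] {M : Type*} [AddCommGroup M] [Module R M]

/-- If `f ∣ g`, every power of `f` acts invertibly on `M_g`. -/
theorem isUnit_algebraMap_end_of_dvd {f g : R} (h : f ∣ g) (s : Submonoid.powers f) :
    IsUnit (algebraMap R
      (Module.End R (LocalizedModule (Submonoid.powers g) M)) (s : R)) := by
  obtain ⟨_, n, rfl⟩ := s
  obtain ⟨c, rfl⟩ := h
  have hu := IsLocalizedModule.map_units
    (LocalizedModule.mkLinearMap (Submonoid.powers (f * c)) M)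
    ⟨f * c, Submonoid.mem_powers (f * c)⟩
  have hu' : IsUnit (algebraMap R
      (Module.End R (LocalizedModule (Submonoid.powers (f * c)) M)) f) := by
    have hc : Commute
        (algebraMap R (Module.End R (LocalizedModule (Submonoid.powers (f * c)) M)) f)
        (algebraMap R (Module.End R (LocalizedModule (Submonoid.powers (f * c)) M)) c) :=
      Algebra.commutes _ _
    rw [map_mul] at hu
    exact (hc.isUnit_mul_iff.mp hu).1
  simpa using hu'.pow n

/-- The canonical map `M_f → M_g` for `f ∣ g`. -/
noncomputable def res (M : Type*) [AddCommGroup M] [Module R M] {f g : R} (h : f ∣ g) :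
    LocalizedModule (Submonoid.powers f) M →ₗ[R] LocalizedModule (Submonoid.powers g) M :=
  LocalizedModule.lift (Submonoid.powers f)
    (LocalizedModule.mkLinearMap (Submonoid.powers g) M)
    (isUnit_algebraMap_end_of_dvd h)

/-- All Čech cochains of `M` for the sequence `x`: families `(c_J)` with `c_J ∈ M_{x_J}`, where
`x_J = ∏_{j ∈ J} x_j` and `J` runs over all subsets of the index set. -/
abbrev Cochain {r : ℕ} (x : Fin r → R) (M : Type*) [AddCommGroup M] [Module R M] : Type _ :=
  (J : Finset (Fin r)) → LocalizedModule (Submonoid.powers (∏ j ∈ J, x j)) M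

/-- The Čech differential `(d c)_J = ∑_{j ∈ J} (-1)^{#{i ∈ J, i < j}} c_{J ∖ {j}}|_{x_J}`. -/
noncomputable def cechD {r : ℕ} (x : Fin r → R) (M : Type*) [AddCommGroup M] [Module R M] :
    Cochain x M →ₗ[R] Cochain x M :=
  LinearMap.pi fun J => ∑ j ∈ J, ((-1 : R) ^ (J.filter (· < j)).card) •
    (res M (Finset.prod_dvd_prod_of_subset (J.erase j) J x (Finset.erase_subset j J))).comp
      (LinearMap.proj (J.erase j))

/-- The degree `n` part of `M_{x_J}` for a grading `ℳ` of `M` and elements `x_j` of degree one: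
the fractions `m / x_J^k` with `m` homogeneous of degree `n + k * #J`. -/
noncomputable def locDegree (ℳ : ℤ → AddSubgroup M) {r : ℕ} (x : Fin r → R)
    (J : Finset (Fin r)) (n : ℤ) :
    AddSubgroup (LocalizedModule (Submonoid.powers (∏ j ∈ J, x j)) M) :=
  AddSubgroup.closure {z | ∃ k : ℕ, ∃ m ∈ ℳ (n + k * J.card),
    z = LocalizedModule.mk m (Submonoid.pow (∏ j ∈ J, x j) k)}

/-- The Čech cochains of cohomological degree `p` and internal degree `n`. -/
noncomputable def cochains (ℳ : ℤ → AddSubgroup M) {r : ℕ} (x : Fin r → R) (p : ℕ) (n : ℤ) :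
    AddSubgroup (Cochain x M) where
  carrier := {c | ∀ J, c J ∈ locDegree ℳ x J n ∧ (J.card ≠ p → c J = 0)}
  zero_mem' _ := ⟨zero_mem _, fun _ => rfl⟩
  add_mem' ha hb J := ⟨add_mem (ha J).1 (hb J).1, fun h => by
    rw [Pi.add_apply, (ha J).2 h, (hb J).2 h, add_zero]⟩
  neg_mem' ha J := ⟨neg_mem (ha J).1, fun h => by rw [Pi.neg_apply, (ha J).2 h, neg_zero]⟩

/-- Cocycles of cohomological degree `p` and internal degree `n`. -/
noncomputable def cocycles (ℳ : ℤ → AddSubgroup M) {r : ℕ} (x : Fin r → R) (p : ℕ) (n : ℤ) :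
    AddSubgroup (Cochain x M) :=
  cochains ℳ x p n ⊓ (cechD x M).toAddMonoidHom.ker

/-- Coboundaries of cohomological degree `p` and internal degree `n`; there are none but `0` in
cohomological degree `0`. -/
noncomputable def coboundaries (ℳ : ℤ → AddSubgroup M) {r : ℕ} (x : Fin r → R) :
    ℕ → ℤ → AddSubgroup (Cochain x M)
  | 0, _ => ⊥
  | p + 1, n => (cochains ℳ x p n).map (cechD x M).toAddMonoidHom

/-- The degree `n` part of the `p`-th local cohomology module of the graded module `M` with respect
to the ideal generated by the degree one elements `x_0, …, x_{r-1}`. -/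
abbrev LocalCohomology (ℳ : ℤ → AddSubgroup M) {r : ℕ} (x : Fin r → R) (p : ℕ) (n : ℤ) : Type _ :=
  cocycles ℳ x p n ⧸ (coboundaries ℳ x p n).addSubgroupOf (cocycles ℳ x p n)

/-- `a_p(M)`: the largest degree in which the `p`-th local cohomology is nonzero
(`⊥ = -∞` if it vanishes, `⊤ = +∞` if there is no largest degree). -/
noncomputable def aInvariant (ℳ : ℤ → AddSubgroup M) {r : ℕ} (x : Fin r → R) (p : ℕ) :
    WithBot (WithTop ℤ) :=
  ⨆ (n : ℤ) (_ : Nontrivial (LocalCohomology ℳ x p n)), ((n : WithTop ℤ) : WithBot (WithTop ℤ))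

/-- Castelnuovo-Mumford regularity `max {a_p(M) + p | p ≥ 0}`. -/
noncomputable def regularity (ℳ : ℤ → AddSubgroup M) {r : ℕ} (x : Fin r → R) :
    WithBot (WithTop ℤ) :=
  ⨆ p : ℕ, aInvariant ℳ x p + (((p : ℤ) : WithTop ℤ) : WithBot (WithTop ℤ))

end Cech

/-! ## The associated graded ring -/

section Gr

variable {A : Type*} [CommRing A]

/-- The associated graded ring `gr_I(A) = ⨁ I^n / I^{n+1}`, as the quotient of the Rees algebra
`A[It] = ⨁ I^n t^n` by its ideal `I A[It] = ⨁ I^{n+1} t^n`. -/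
abbrev Gr (I : Ideal A) : Type _ :=
  reesAlgebra I ⧸ I.map (algebraMap A (reesAlgebra I))

/-- The degree `n` component `I^n / I^{n+1}` of `gr_I(A)`, i.e. the classes of the elements `a t^n`
with `a ∈ I^n`; it is zero for negative `n`. -/
noncomputable def grComponent (I : Ideal A) (n : ℤ) : Submodule A (Gr I) :=
  Submodule.map (Ideal.Quotient.mkₐ A (I.map (algebraMap A (reesAlgebra I)))).toLinearMap
    { carrier := {f : reesAlgebra I | ∀ j : ℕ, (j : ℤ) ≠ n → (f : Polynomial A).coeff j = 0}
      add_mem' := fun ha hb j hj => by simp [ha j hj, hb j hj]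
      zero_mem' := fun j _ => by simp
      smul_mem' := fun c f hf j hj => by simp [hf j hj] }

/-- The class in `I / I^2 = gr_I(A)_1` of an element `a ∈ I`. -/
noncomputable def grDegreeOne (I : Ideal A) (a : I) : Gr I :=
  Ideal.Quotient.mk _ ⟨Polynomial.monomial 1 (a : A),
    reesAlgebra.monomial_mem.mpr (by rw [pow_one]; exact a.2)⟩

/-- A finite family of elements generates the ideal `I`. -/
theorem exists_generators [IsNoetherianRing A] (I : Ideal A) :
    ∃ (r : ℕ) (a : Fin r → I), Ideal.span (Set.range fun i => (a i : A)) = I := by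
  obtain ⟨r, s, hs⟩ := Submodule.fg_iff_exists_fin_generating_family.mp
    (IsNoetherian.noetherian I)
  exact ⟨r, fun i => ⟨s i, hs ▸ Submodule.subset_span ⟨i, rfl⟩⟩, hs⟩

/-- The size of a finite generating family of `I`, chosen once and for all. -/
noncomputable def numGens [IsNoetherianRing A] (I : Ideal A) : ℕ := (exists_generators I).choose

/-- A finite generating family of `I`, chosen once and for all. -/
noncomputable def gens [IsNoetherianRing A] (I : Ideal A) : Fin (numGens I) → I :=
  (exists_generators I).choose_spec.choose

/-- The Castelnuovo-Mumford regularity of `G = gr_I(A)`, computed from the local cohomology of `G`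
with respect to `G_+`; the classes in `G_1` of generators of `I` generate `G_+`
(local cohomology does not depend on the choice of these generators). -/
noncomputable def regGr [IsNoetherianRing A] (I : Ideal A) : WithBot (WithTop ℤ) :=
  regularity (R := Gr I) (fun n => (grComponent I n).toAddSubgroup)
    (fun i => grDegreeOne I (gens I i))

/-- The Hilbert function `h_G(t) = λ(I^t / I^{t+1})` of `G = gr_I(A)`
(used where this length is finite). -/
noncomputable def hilbertFn (I : Ideal A) (t : ℕ) : ℕ :=
  (Module.length A (grComponent I t)).toNat

/-- The first iterated Hilbert function `h^1_G(t) = ∑_{j=0}^t h_G(j)` of `G = gr_I(A)`. -/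
noncomputable def hilbertFn1 (I : Ideal A) (t : ℕ) : ℕ :=
  ∑ j ∈ Finset.range (t + 1), hilbertFn I j

end Gr

/-! ## Local rings -/

section LocalRing

variable (A : Type*) [CommRing A] [IsLocalRing A]

/-- The depth of a local ring: the supremum of the lengths of the regular sequences contained in the
maximal ideal. -/
noncomputable def depth : ℕ∞ :=
  ⨆ (s : List A) (_ : (∀ a ∈ s, a ∈ IsLocalRing.maximalIdeal A) ∧
    RingTheory.Sequence.IsRegular A s), (s.length : ℕ∞)

variable {A}

/-- `x ∈ 𝔪` is superficial: there is `c` with `(𝔪^{n+1} : x) ∩ 𝔪^c = 𝔪^n` for all `n ≥ c`. -/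
def IsSuperficial (x : A) : Prop :=
  x ∈ IsLocalRing.maximalIdeal A ∧
    ∃ c : ℕ, ∀ n ≥ c, ∀ a : A,
      (x * a ∈ IsLocalRing.maximalIdeal A ^ (n + 1) ∧ a ∈ IsLocalRing.maximalIdeal A ^ c) ↔
        a ∈ IsLocalRing.maximalIdeal A ^ n

end LocalRing

end LocalMumford

/-!
# The regularity of the associated graded ring modulo a superficial element

Write `I` for the maximal ideal of `A`, `G = gr_I(A)` and `Ḡ` for the associated graded ring of
`A/xA`, and let `m = reg(Ḡ)`.

*Regularity and Koszul complexes.* For a graded module `M` and elements `x_j` of degree one, all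
local cohomology vanishes in the levels (cohomological plus internal degree) above `m` if and only
if the Koszul complex of the `x_j` on `M` is exact there. One direction holds as the Čech complex is
the colimit of the Koszul complexes of powers of the `x_j` (`cechExact_of_koszulExact`), the other by
comparing both with the double complex that they form (`koszulExact_of_cechExact`); the latter allows
different generators for the two complexes. So the regularity is the last level in which the Koszul
complex is not exact, and it is a natural number for `Ḡ` (`exists_regGr_eq`): the Koszul homology of
a finitely generated module is killed by the elements of degree one, hence bounded above, and the
unit in the top exterior power lies in level `0`.

*Reduction to colon ideals.* A superficial element of a ring of positive depth is a nonzerodivisor,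
and `I^{n+1} : x = I^n` for large `n`. If this equality holds for all `n ≥ N` with `N ≥ m`, then
multiplication by the class of `x` is injective on `G` in degrees `≥ N` with cokernel `Ḡ`; since it
is null-homotopic on the Koszul complex, `reg(G) ≤ N` (`grExact_of_quotient`). So it remains to see
that the equality holds for `n ≥ m + h¹(m)` (`colonPow_le_pow_of_ge`).

*The bound.* Let `Γ_n ⊇ I^n` be the sections of degree `n` over `Proj` of the Rees algebra `A[It]`,
as a submodule of `A_x` (`satPow`), and `Q_n = Γ_n / (Γ_{n+1} + I^n)`. In degrees `n ≥ m` the local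
cohomology of `A[It]` modulo `x` is under control, as `Ḡ` has none above level `m`. Therefore
multiplication by `x` maps `Q_n` onto `Q_{n+1}` (`exists_smul_add_of_mem_satPow`), and its kernel is
the image of `I^{n+1} : x` (`exists_algebraMap_eq_of_smul_mem`). The vanishing of the first Koszul
homology of `Ḡ` shows that `I^{n+1} : x` generates `I^{n+2} : x` (`colonPow_succ_le_mul`). Hence once
`Q_n → Q_{n+1}` is injective, so are all later maps, and `Q_n = 0` as `Q_k = 0` for large `k`: the
lengths of the `Q_n` decrease strictly to zero. The length of `Q_m` is at most that of the cokernel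
of `x` on `Γ_m / I^{m+1}`, which is the length of the kernel, hence of the kernel
`(I^{m+1} : x) / I^{m+1}` and of the cokernel of `x` on `A / I^{m+1}`. This cokernel is
`A / (I^{m+1} + xA)`, of length `h¹(m)` (`length_satQuotient_le`). So `Q_n = 0` for
`n ≥ m + h¹(m)`, and `Γ_n = I^n` there, which contains `I^{n+1} : x`.
-/

namespace LocalMumford

/-! ### Koszul cochains -/

section Koszul

variable {R : Type*} [CommRing R] {M : Type*} [AddCommGroup M] [Module R M] {r : ℕ}

/-- The sign `(-1)^{#{i ∈ J, i < j}}` of the Koszul and Čech differentials. -/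
def koszulSign (R : Type*) [CommRing R] (j : Fin r) (J : Finset (Fin r)) : R :=
  (-1) ^ (J.filter (· < j)).card

theorem koszulSign_mul_self (j : Fin r) (J : Finset (Fin r)) :
    koszulSign R j J * koszulSign R j J = 1 := by
  rw [koszulSign, ← pow_add, ← two_mul, pow_mul]; simp

theorem koszulSign_insert_of_lt {i j : Fin r} {J : Finset (Fin r)} (h : i < j) (hi : i ∉ J) :
    koszulSign R j (insert i J) = -koszulSign R j J := by
  rw [koszulSign, Finset.filter_insert, if_pos h, Finset.card_insert_of_notMem (by simp [hi]),
    pow_succ, mul_neg_one, koszulSign]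

theorem koszulSign_insert_of_not_lt {i j : Fin r} {J : Finset (Fin r)} (h : ¬ i < j) :
    koszulSign R j (insert i J) = koszulSign R j J := by
  rw [koszulSign, Finset.filter_insert, if_neg h, koszulSign]

theorem koszulSign_insert_self (j : Fin r) (J : Finset (Fin r)) :
    koszulSign R j (insert j J) = koszulSign R j J :=
  koszulSign_insert_of_not_lt (lt_irrefl j)

theorem koszulSign_erase_self (j : Fin r) (J : Finset (Fin r)) :
    koszulSign R j (J.erase j) = koszulSign R j J := by
  by_cases h : j ∈ J
  · rw [← koszulSign_insert_self, Finset.insert_erase h]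
  · rw [Finset.erase_eq_of_notMem h]

/-- Exterior multiplication by the `j`-th basis vector on `M ⊗ Λ(R^r)`, whose elements are written
as families indexed by the subsets of `Fin r`. -/
def wedge (j : Fin r) : (Finset (Fin r) → M) →ₗ[R] (Finset (Fin r) → M) :=
  LinearMap.pi fun J =>
    if j ∈ J then koszulSign R j J • LinearMap.proj (J.erase j) else 0

/-- Contraction with the `j`-th dual basis vector on `M ⊗ Λ(R^r)`. -/
def contract (j : Fin r) : (Finset (Fin r) → M) →ₗ[R] (Finset (Fin r) → M) :=
  LinearMap.pi fun J =>
    if j ∈ J then 0 else koszulSign R j J • LinearMap.proj (insert j J)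

theorem wedge_apply (j : Fin r) (c : Finset (Fin r) → M) (J : Finset (Fin r)) :
    wedge (R := R) j c J = if j ∈ J then koszulSign R j J • c (J.erase j) else 0 := by
  simp only [wedge, LinearMap.pi_apply]; split_ifs <;> simp

theorem contract_apply (j : Fin r) (c : Finset (Fin r) → M) (J : Finset (Fin r)) :
    contract (R := R) j c J = if j ∈ J then 0 else koszulSign R j J • c (insert j J) := by
  simp only [contract, LinearMap.pi_apply]; split_ifs <;> simp

theorem contract_wedge_self_apply (j : Fin r) (c : Finset (Fin r) → M) (J : Finset (Fin r)) :
    contract (R := R) j (wedge (R := R) j c) J = if j ∈ J then 0 else c J := by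
  rw [contract_apply]
  split_ifs with h
  · rfl
  · rw [wedge_apply, if_pos (Finset.mem_insert_self j J), Finset.erase_insert h,
      koszulSign_insert_self, smul_smul, koszulSign_mul_self, one_smul]

theorem wedge_contract_self_apply (j : Fin r) (c : Finset (Fin r) → M) (J : Finset (Fin r)) :
    wedge (R := R) j (contract (R := R) j c) J = if j ∈ J then c J else 0 := by
  rw [wedge_apply]
  split_ifs with h
  · rw [contract_apply, if_neg (Finset.notMem_erase j J), Finset.insert_erase h,
      koszulSign_erase_self, smul_smul, koszulSign_mul_self, one_smul]
  · rfl

theorem contract_wedge_add_self (j : Fin r) (c : Finset (Fin r) → M) :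
    contract (R := R) j (wedge (R := R) j c) + wedge (R := R) j (contract (R := R) j c) = c := by
  funext J
  rw [Pi.add_apply, contract_wedge_self_apply, wedge_contract_self_apply]
  split_ifs <;> simp

/-- The two signs picked up by inserting `i` and `j` in either order are opposite. -/
theorem koszulSign_swap {i j : Fin r} (h : i ≠ j) {J : Finset (Fin r)} (hi : i ∉ J) (hj : j ∉ J) :
    koszulSign R j (insert i J) * koszulSign R i J
      = -(koszulSign R i (insert j J) * koszulSign R j J) := by
  rcases lt_or_gt_of_ne h with h | h
  · rw [koszulSign_insert_of_lt h hi, koszulSign_insert_of_not_lt h.not_gt]; ring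
  · rw [koszulSign_insert_of_lt h hj, koszulSign_insert_of_not_lt h.not_gt]; ring

theorem wedge_wedge_add (i j : Fin r) (c : Finset (Fin r) → M) :
    wedge (R := R) i (wedge (R := R) j c) + wedge (R := R) j (wedge (R := R) i c) = 0 := by
  funext J
  simp only [Pi.add_apply, wedge_apply, Pi.zero_apply, Finset.mem_erase]
  by_cases hij : i = j
  · subst hij; simp
  by_cases hi : i ∈ J
  swap
  · simp [hi]
  by_cases hj : j ∈ J
  swap
  · simp [hj]
  obtain ⟨K, hK⟩ : ∃ K, K = (J.erase i).erase j := ⟨_, rfl⟩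
  have hiK : i ∉ K := by simp [hK]
  have hjK : j ∉ K := by simp [hK]
  have h1 : J.erase i = insert j K := by
    rw [hK, Finset.insert_erase]; simp [hj, Ne.symm hij]
  have h2 : J.erase j = insert i K := by
    rw [hK, Finset.erase_right_comm, Finset.insert_erase]; simp [hi, hij]
  have h3 := koszulSign_erase_self (R := R) i J
  have h4 := koszulSign_erase_self (R := R) j J
  rw [h1] at h3
  rw [h2] at h4
  rw [if_pos hi, if_pos hj, if_pos ⟨Ne.symm hij, hj⟩, if_pos ⟨hij, hi⟩, h1, h2,
    Finset.erase_insert hjK, Finset.erase_insert hiK, smul_smul, smul_smul, ← add_smul, ← h3, ← h4,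
    koszulSign_insert_self, koszulSign_insert_self]
  have := koszulSign_swap (R := R) hij hiK hjK
  rw [this, add_neg_cancel, zero_smul]

theorem wedge_wedge_self (j : Fin r) (c : Finset (Fin r) → M) :
    wedge (R := R) j (wedge (R := R) j c) = 0 := by
  funext J
  simp [wedge_apply]

theorem contract_wedge_add_of_ne {i j : Fin r} (hij : i ≠ j) (c : Finset (Fin r) → M) :
    contract (R := R) i (wedge (R := R) j c) + wedge (R := R) j (contract (R := R) i c) = 0 := by
  funext J
  simp only [Pi.add_apply, wedge_apply, contract_apply, Pi.zero_apply, Finset.mem_erase,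
    Finset.mem_insert]
  by_cases hi : i ∈ J
  · simp [hi, hij]
  by_cases hj : j ∈ J
  swap
  · simp [hj, Ne.symm hij]
  obtain ⟨K, hK⟩ : ∃ K, K = J.erase j := ⟨_, rfl⟩
  have hjK : j ∉ K := by simp [hK]
  have hiK : i ∉ K := by simp [hK, hi]
  have h1 : J = insert j K := by rw [hK, Finset.insert_erase hj]
  have h2 : (insert i J).erase j = insert i K := by
    rw [hK, Finset.erase_insert_of_ne hij]
  rw [if_neg hi, if_pos (Or.inr hj), if_pos hj, if_neg (by simp [hi]), h2, ← hK, smul_smul,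
    smul_smul, ← add_smul, h1, koszulSign_insert_self, Finset.insert_comm,
    koszulSign_insert_self (R := R) j]
  have h := koszulSign_swap (R := R) hij hiK hjK
  have e1 := koszulSign_mul_self (R := R) i K
  have e2 := koszulSign_mul_self (R := R) j K
  have : koszulSign R i (insert j K) * koszulSign R j (insert i K)
      + koszulSign R j K * koszulSign R i K = 0 := by
    linear_combination (koszulSign R i (insert j K) * koszulSign R i K) * h
      - (koszulSign R i (insert j K) * koszulSign R j (insert i K)) * e1
      - (koszulSign R j K * koszulSign R i K) * koszulSign_mul_self (R := R) i (insert j K)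
  rw [this, zero_smul]

/-- The Koszul differential `c ↦ ∑ x_j e_j ∧ c`. -/
def koszulD (x : Fin r → R) (M : Type*) [AddCommGroup M] [Module R M] :
    (Finset (Fin r) → M) →ₗ[R] (Finset (Fin r) → M) :=
  ∑ j, x j • wedge j

theorem koszulD_apply (x : Fin r → R) (c : Finset (Fin r) → M) :
    koszulD x M c = ∑ j, x j • wedge (R := R) j c := by
  simp [koszulD, LinearMap.sum_apply]

theorem koszulD_apply_apply (x : Fin r → R) (c : Finset (Fin r) → M) (J : Finset (Fin r)) :
    koszulD x M c J = ∑ j ∈ J, x j • koszulSign R j J • c (J.erase j) := by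
  simp [koszulD_apply, Finset.sum_apply, wedge_apply]

theorem koszulD_eq_zero_of_top (x : Fin r → R) {c : Finset (Fin r) → M}
    (hc : ∀ J, J ≠ Finset.univ → c J = 0) : koszulD x M c = 0 := by
  funext J
  rw [koszulD_apply_apply]
  refine Finset.sum_eq_zero fun j _ => ?_
  rw [hc, smul_zero, smul_zero]
  intro hJ
  exact Finset.notMem_erase j J (hJ ▸ Finset.mem_univ j)

theorem koszulD_koszulD (x : Fin r → R) (c : Finset (Fin r) → M) :
    koszulD x M (koszulD x M c) = 0 := by
  have key : ∀ i j : Fin r, (x i * x j) • wedge (R := R) i (wedge (R := R) j c)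
      + (x j * x i) • wedge (R := R) j (wedge (R := R) i c) = 0 := fun i j => by
    rw [mul_comm (x j), ← smul_add, wedge_wedge_add, smul_zero]
  have e : koszulD x M (koszulD x M c)
      = ∑ p : Fin r × Fin r, (x p.1 * x p.2) • wedge (R := R) p.1 (wedge (R := R) p.2 c) := by
    rw [koszulD_apply, koszulD_apply, Fintype.sum_prod_type]
    simp only [map_sum, map_smul, Finset.smul_sum, smul_smul]
  rw [e]
  refine Finset.sum_involution (fun p _ => p.swap) (fun p _ => key p.1 p.2) ?_ (by simp) (by simp)
  rintro ⟨i, j⟩ - hne heq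
  simp only [Prod.swap_prod_mk, Prod.mk.injEq] at heq
  obtain ⟨rfl, -⟩ := heq
  simp [wedge_wedge_self] at hne

/-- Contraction with `∑ c_j e_j^*` is a homotopy between `0` and multiplication by
`∑ c_j x_j` on the Koszul complex. -/
theorem koszulD_contract_add (x a : Fin r → R) (c : Finset (Fin r) → M) :
    koszulD x M (∑ i, a i • contract (R := R) i c)
      + ∑ i, a i • contract (R := R) i (koszulD x M c) = (∑ i, a i * x i) • c := by
  rw [map_sum, ← Finset.sum_add_distrib, Finset.sum_smul]
  refine Finset.sum_congr rfl fun i _ => ?_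
  rw [map_smul, ← smul_add, mul_smul]
  congr 1
  rw [koszulD_apply, koszulD_apply, map_sum, ← Finset.sum_add_distrib,
    Finset.sum_eq_single_of_mem i (Finset.mem_univ i)]
  · rw [map_smul, ← smul_add, add_comm, contract_wedge_add_self]
  · intro j _ hj
    rw [map_smul, ← smul_add, add_comm, contract_wedge_add_of_ne hj.symm, smul_zero]

section Naturality

variable {N : Type*} [AddCommGroup N] [Module R N]

theorem koszulD_map (f : M →ₗ[R] N) (x : Fin r → R) (c : Finset (Fin r) → M) :
    koszulD x N (fun J => f (c J)) = fun J => f (koszulD x M c J) := by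
  funext J
  simp [koszulD_apply_apply]

end Naturality

/-- The Koszul complex of `x` on `M` is exact at the cochains with values in `F_ℓ`, with
bounding cochains having values in `F_{ℓ-1}`. -/
def KoszulExact (F : ℤ → AddSubgroup M) (x : Fin r → R) (ℓ : ℤ) : Prop :=
  ∀ c : Finset (Fin r) → M, (∀ J, c J ∈ F ℓ) → koszulD x M c = 0 →
    ∃ b : Finset (Fin r) → M, (∀ J, b J ∈ F (ℓ - 1)) ∧ koszulD x M b = c

/-- The analogue of `KoszulExact` for the sequence of powers `x_j^{e_j+1}`. The value at `J` of a
cochain of level `ℓ` lies in `F_{ℓ + ∑_{j ∈ J} e_j}`, so that the differential raises the level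
by one. -/
def KoszulExactPow (F : ℤ → AddSubgroup M) (x : Fin r → R) (e : Fin r → ℕ) (ℓ : ℤ) : Prop :=
  ∀ c : Finset (Fin r) → M, (∀ J, c J ∈ F (ℓ + ∑ j ∈ J, (e j : ℤ))) →
    koszulD (fun j => x j ^ (e j + 1)) M c = 0 →
    ∃ b : Finset (Fin r) → M, (∀ J, b J ∈ F (ℓ - 1 + ∑ j ∈ J, (e j : ℤ))) ∧
      koszulD (fun j => x j ^ (e j + 1)) M b = c

theorem smul_pow_mem {F : ℤ → AddSubgroup M} {y : R} (hy : ∀ n, ∀ m ∈ F n, y • m ∈ F (n + 1))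
    (k : ℕ) (n : ℤ) {m : M} (hm : m ∈ F n) : y ^ k • m ∈ F (n + k) := by
  induction k with
  | zero => simpa using hm
  | succ k ih =>
    rw [pow_succ', mul_smul, Nat.cast_succ, ← add_assoc]
    exact hy _ _ ih

end Koszul

/-! ### Koszul exactness for powers of the elements -/

section KoszulPow

variable {R : Type*} [CommRing R] {M : Type*} [AddCommGroup M] [Module R M] {r : ℕ}

theorem wedge_koszulD (z : Fin r → R) (i : Fin r)
    (c : Finset (Fin r) → M) :
    wedge (R := R) i (koszulD z M c) = -koszulD z M (wedge (R := R) i c) := by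
  rw [eq_neg_iff_add_eq_zero, koszulD_apply, koszulD_apply, map_sum, ← Finset.sum_add_distrib]
  refine Finset.sum_eq_zero fun j _ => ?_
  rw [map_smul, ← smul_add, wedge_wedge_add, smul_zero]

theorem contract_koszulD_of_eq_zero {z : Fin r → R} {i : Fin r} (hz : z i = 0)
    (c : Finset (Fin r) → M) :
    contract (R := R) i (koszulD z M c) = -koszulD z M (contract (R := R) i c) := by
  rw [eq_neg_iff_add_eq_zero, koszulD_apply, koszulD_apply, map_sum, ← Finset.sum_add_distrib]
  refine Finset.sum_eq_zero fun j _ => ?_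
  rw [map_smul, ← smul_add]
  by_cases h : i = j
  · subst h; rw [hz, zero_smul]
  · rw [contract_wedge_add_of_ne h, smul_zero]

theorem wedge_contract_wedge (i : Fin r) (c : Finset (Fin r) → M) :
    wedge (R := R) i (contract (R := R) i (wedge (R := R) i c)) = wedge (R := R) i c := by
  funext J
  rw [wedge_contract_self_apply, wedge_apply]
  split_ifs <;> rfl

theorem koszulD_update (x : Fin r → R) (e : Fin r → ℕ) (i : Fin r) (k : ℕ)
    (c : Finset (Fin r) → M) :
    koszulD (fun j => x j ^ (Function.update e i k j + 1)) M c
      = koszulD (fun j => if j = i then 0 else x j ^ (e j + 1)) M c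
        + x i ^ (k + 1) • wedge (R := R) i c := by
  rw [koszulD_apply, koszulD_apply, ← Finset.add_sum_erase _ _ (Finset.mem_univ i),
    ← Finset.add_sum_erase (a := i) _ (fun j => (if j = i then (0 : R) else _) • _)
      (Finset.mem_univ i), Function.update_self, if_pos rfl, zero_smul, zero_add, add_comm]
  congr 1
  refine Finset.sum_congr rfl fun j hj => ?_
  rw [Function.update_of_ne (Finset.ne_of_mem_erase hj), if_neg (Finset.ne_of_mem_erase hj)]

theorem sum_update (e : Fin r → ℕ) (i : Fin r) (k : ℕ) (J : Finset (Fin r)) :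
    ∑ j ∈ J, ((Function.update e i k j : ℕ) : ℤ)
      = ∑ j ∈ J.erase i, (e j : ℤ) + if i ∈ J then (k : ℤ) else 0 := by
  have h : ∑ j ∈ J.erase i, ((Function.update e i k j : ℕ) : ℤ) = ∑ j ∈ J.erase i, (e j : ℤ) :=
    Finset.sum_congr rfl fun j hj => by rw [Function.update_of_ne (Finset.ne_of_mem_erase hj)]
  split_ifs with hi
  · rw [← Finset.sum_erase_add _ _ hi, h, Function.update_self]
  · rw [← h, Finset.erase_eq_of_notMem hi, add_zero]

/-- Exactness for the exponents `a` and `0` at the index `i` gives exactness for `a + 1`: the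
Koszul complex of `y^{a+2}` is an extension of those of `y^{a+1}` and `y`. -/
theorem KoszulExactPow.update_succ {F : ℤ → AddSubgroup M} {x : Fin r → R}
    (hx : ∀ j n, ∀ m ∈ F n, x j • m ∈ F (n + 1)) {e : Fin r → ℕ} {ℓ : ℤ} (i : Fin r) (a : ℕ)
    (h : KoszulExactPow F x (Function.update e i a) (ℓ + 1))
    (h0 : KoszulExactPow F x (Function.update e i 0) ℓ) :
    KoszulExactPow F x (Function.update e i (a + 1)) ℓ := by
  intro c hc hdc
  simp only [KoszulExactPow, koszulD_update, sum_update] at *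
  set D := koszulD (fun j => if j = i then 0 else x j ^ (e j + 1)) M with hD
  set W : (Finset (Fin r) → M) →ₗ[R] (Finset (Fin r) → M) := wedge (R := R) i
  set C : (Finset (Fin r) → M) →ₗ[R] (Finset (Fin r) → M) := contract (R := R) i
  set y := x i with hy
  have hWD : ∀ c, W (D c) = -D (W c) := fun c => wedge_koszulD _ i c
  have hCD : ∀ c, C (D c) = -D (C c) := fun c =>
    contract_koszulD_of_eq_zero (by simp) c
  have hCWD : ∀ c, C (W (D c)) = D (C (W c)) := fun c => by rw [hWD, map_neg, hCD, neg_neg]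
  have hWCD : ∀ c, W (C (D c)) = D (W (C c)) := fun c => by rw [hCD, map_neg, hWD, neg_neg]
  have hWW : ∀ c, W (W c) = 0 := fun c => wedge_wedge_self i c
  have hWCW : ∀ c, W (C (W c)) = W c := fun c => wedge_contract_wedge i c
  have hsum : ∀ c, C (W c) + W (C c) = c := fun c => contract_wedge_add_self i c
  have hWCCW : ∀ c, W (C (C (W c))) = 0 := fun c => by
    have := hsum (C (W c)); rw [hWCW] at this; simpa using this
  have hWCWC : ∀ c, W (C (W (C c))) = W (C c) := fun c => hWCW _
  -- `C W` and `W C` are the projections to the components `J` without and with `i`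
  have PJ : ∀ c J, C (W c) J = if i ∈ J then 0 else c J := fun c J =>
    contract_wedge_self_apply i c J
  have QJ : ∀ c J, W (C c) J = if i ∈ J then c J else 0 := fun c J =>
    wedge_contract_self_apply i c J
  have A1 : D (C (W c)) = 0 := by
    have := congrArg (fun t => C (W t)) hdc
    simpa [hCWD, hWW] using this
  have A2 : D (W (C c)) + y ^ (a + 1 + 1) • W c = 0 := by
    have := congrArg (fun t => W (C t)) hdc
    simpa [hWCD, hWCW] using this
  obtain ⟨b1, hb1, hdb1⟩ := h (y • C (W c) + W (C c)) (fun J => by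
    have h1 := hc J
    rw [Pi.add_apply, Pi.smul_apply, PJ, QJ]
    split_ifs with hi
    · rw [if_pos hi] at h1
      rw [smul_zero, zero_add]
      convert h1 using 2
      push_cast; ring
    · rw [if_neg hi] at h1
      rw [add_zero, add_zero, add_right_comm]
      rw [add_zero] at h1
      exact hx _ _ _ h1) (by
    simp only [map_add, map_smul, A1, hWCW, hWW, smul_zero, zero_add, add_zero, smul_smul]
    rw [← pow_succ, A2])
  have B2 : D (W (C b1)) + y ^ (a + 1) • W b1 = W (C c) := by
    have := congrArg (fun t => W (C t)) hdb1
    simpa [hWCD, hWCW, hWCCW, hWCWC] using this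
  have B3 : W (D b1) = y • W c := by
    have := congrArg (fun t => W t) hdb1
    simpa [hWCW, hWW] using this
  obtain ⟨b2, hb2, hdb2⟩ := h0 (C (W c) + W b1) (fun J => by
    have h1 := hc J
    rw [Pi.add_apply, PJ]
    split_ifs with hi
    · have h2 := hb1 (J.erase i)
      rw [if_neg (Finset.notMem_erase i J), Finset.erase_idem] at h2
      rw [zero_add, wedge_apply, if_pos hi]
      have h3 : b1 (J.erase i) ∈ F (ℓ + (∑ j ∈ J.erase i, (e j : ℤ) + (0 : ℕ))) := by
        convert h2 using 2; push_cast; ring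
      rcases neg_one_pow_eq_or R (J.filter (· < i)).card with h4 | h4
      · rw [koszulSign, h4, one_smul]; exact h3
      · rw [koszulSign, h4, neg_smul, one_smul]; exact neg_mem h3
    · rw [if_neg hi] at h1
      rw [wedge_apply, if_neg hi]
      simpa using h1) (by
    simp only [map_add, A1, hWCW, hWW, zero_add, add_zero, pow_one]
    have : D (W b1) = -(y • W c) := by rw [← B3, hWD, neg_neg]
    rw [this, neg_add_cancel])
  rw [zero_add, pow_one] at hdb2
  have E1 : D (C (W b2)) = C (W c) := by
    have := congrArg (fun t => C (W t)) hdb2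
    simpa [hCWD, hWW, hWCW] using this
  have E2 : D (W (C b2)) + y • W b2 = W b1 := by
    have := congrArg (fun t => W (C t)) hdb2
    simpa [hWCD, hWCW, hWCCW] using this
  refine ⟨C (W b2) + y ^ (a + 1) • W (C b2) + W (C b1), fun J => ?_, ?_⟩
  · have h2 := hb2 J
    have h1 := hb1 J
    rw [Pi.add_apply, Pi.add_apply, Pi.smul_apply, PJ, QJ, QJ]
    split_ifs with hi
    · rw [if_pos hi] at h1 h2
      rw [zero_add]
      refine add_mem ?_ ?_
      · have := smul_pow_mem (F := F) (y := y) (hx i) (a + 1) _ h2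
        convert this using 2; push_cast; ring
      · convert h1 using 2; push_cast; ring
    · rw [if_neg hi] at h2
      simpa using h2
  · simp only [map_add, map_smul, hWCW, hWW, smul_zero, add_zero]
    rw [E1]
    refine Eq.trans ?_ (hsum c)
    rw [← B2, ← E2]
    module

/-- If the Koszul complex of `x` on `F` is exact in all levels above `m`, then so is the Koszul
complex of any sequence of powers of the `x_j`. -/
theorem koszulExactPow_of_koszulExact {F : ℤ → AddSubgroup M} {x : Fin r → R}
    (hx : ∀ j n, ∀ m ∈ F n, x j • m ∈ F (n + 1)) {m : ℤ}
    (h : ∀ ℓ > m, KoszulExact F x ℓ) (e : Fin r → ℕ) :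
    ∀ ℓ > m, KoszulExactPow F x e ℓ := by
  suffices H : ∀ S : Finset (Fin r), ∀ e : Fin r → ℕ, (∀ j ∉ S, e j = 0) →
      ∀ ℓ > m, KoszulExactPow F x e ℓ from
    H Finset.univ e fun j hj => absurd (Finset.mem_univ j) hj
  intro S
  induction S using Finset.induction_on with
  | empty =>
    intro e he ℓ hℓ
    have : e = fun _ => 0 := funext fun j => he j (Finset.notMem_empty j)
    subst this
    simpa [KoszulExactPow, KoszulExact] using h ℓ hℓ
  | insert i S hi ih =>
    intro e he
    have h0 : ∀ ℓ > m, KoszulExactPow F x (Function.update e i 0) ℓ :=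
      ih _ fun j hj => by
        by_cases hji : j = i
        · rw [hji, Function.update_self]
        · rw [Function.update_of_ne hji]
          exact he j (by simp [hj, hji])
    have key : ∀ a : ℕ, ∀ ℓ > m, KoszulExactPow F x (Function.update e i a) ℓ := by
      intro a
      induction a with
      | zero => exact h0
      | succ a iha =>
        exact fun ℓ hℓ => (iha (ℓ + 1) (by lia)).update_succ hx i a (h0 ℓ hℓ)
    have := key (e i)
    rwa [Function.update_eq_self] at this

end KoszulPow

/-! ### Comparison of Koszul and Čech cochains -/

section Cech

variable {R : Type*} [CommRing R] {M : Type*} [AddCommGroup M] [Module R M] {r : ℕ}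

theorem mk_pow_add (m : M) (f : R) (k l : ℕ) :
    LocalizedModule.mk (f ^ l • m) (Submonoid.pow f (k + l))
      = LocalizedModule.mk m (Submonoid.pow f k) := by
  rw [LocalizedModule.mk_eq]
  refine ⟨1, ?_⟩
  simp only [one_smul, Submonoid.smul_def, Submonoid.pow_apply, smul_smul]
  rw [pow_add]

theorem res_mk {f g c : R} (h : f ∣ g) (hg : g = f * c) (m : M) (k : ℕ) :
    res M h (LocalizedModule.mk m (Submonoid.pow f k))
      = LocalizedModule.mk (c ^ k • m) (Submonoid.pow g k) := by
  have hu := isUnit_algebraMap_end_of_dvd (M := M) h (Submonoid.pow f k)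
  rw [Module.End.isUnit_iff] at hu
  apply hu.injective
  have h1 : algebraMap R (Module.End R (LocalizedModule (Submonoid.powers g) M))
      (Submonoid.pow f k : R) (res M h (LocalizedModule.mk m (Submonoid.pow f k)))
      = LocalizedModule.mk m 1 := by
    rw [Module.algebraMap_end_apply, ← map_smul, LocalizedModule.smul'_mk, ← Submonoid.smul_def,
      LocalizedModule.mk_cancel, ← LocalizedModule.mkLinearMap_apply]
    exact DFunLike.congr_fun (LocalizedModule.lift_comp (Submonoid.powers f)
      (LocalizedModule.mkLinearMap (Submonoid.powers g) M) (isUnit_algebraMap_end_of_dvd h)) m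
  rw [h1, Module.algebraMap_end_apply, LocalizedModule.smul'_mk, LocalizedModule.mk_eq]
  refine ⟨1, ?_⟩
  simp only [one_smul, Submonoid.smul_def, Submonoid.pow_apply, smul_smul]
  rw [hg, mul_pow]

/-- The map from the Koszul complex of the powers `x_j^k` to the Čech complex which sends a family
`(c_J)` to `(c_J / x_J^k)`. -/
noncomputable def koszulToCech (x : Fin r → R) (k : ℕ) (c : Finset (Fin r) → M) : Cochain x M :=
  fun J => LocalizedModule.mk (c J) (Submonoid.pow (∏ j ∈ J, x j) k)

theorem mk_finset_sum {f : R} (s : Submonoid.powers f) {ι : Type*} (J : Finset ι) (c : ι → M) :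
    LocalizedModule.mk (∑ j ∈ J, c j) s = ∑ j ∈ J, LocalizedModule.mk (c j) s := by
  have : ∀ m : M, LocalizedModule.mk m s = LocalizedModule.divBy s (LocalizedModule.mk m 1) :=
    fun m => by rw [LocalizedModule.divBy_apply, LocalizedModule.liftOn_mk, one_mul]
  simp only [this, ← LocalizedModule.mkLinearMap_apply, map_sum]

theorem cechD_apply (x : Fin r → R) (c : Cochain x M) (J : Finset (Fin r)) :
    cechD x M c J = ∑ j ∈ J, koszulSign R j J •
      res M (Finset.prod_dvd_prod_of_subset (J.erase j) J x (Finset.erase_subset j J))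
        (c (J.erase j)) := by
  simp [cechD, LinearMap.sum_apply, koszulSign]

theorem cechD_koszulToCech (x : Fin r → R) (k : ℕ) (c : Finset (Fin r) → M) :
    cechD x M (koszulToCech x k c)
      = koszulToCech x k (koszulD (fun j => x j ^ k) M c) := by
  funext J
  rw [cechD_apply, koszulToCech, koszulD_apply_apply, mk_finset_sum]
  refine Finset.sum_congr rfl fun j hj => ?_
  rw [koszulToCech, res_mk _ (c := x j) (Finset.prod_erase_mul J x hj).symm,
    LocalizedModule.smul'_mk, smul_comm]

theorem koszulToCech_add (x : Fin r → R) (k l : ℕ) (c : Finset (Fin r) → M) :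
    koszulToCech x (k + l) (fun J => (∏ j ∈ J, x j) ^ l • c J) = koszulToCech x k c := by
  funext J
  exact mk_pow_add _ _ _ _

theorem koszulD_prod_pow_smul (x : Fin r → R) (k l : ℕ) (c : Finset (Fin r) → M) :
    koszulD (fun j => x j ^ (k + l)) M (fun J => (∏ j ∈ J, x j) ^ l • c J)
      = fun J => (∏ j ∈ J, x j) ^ l • koszulD (fun j => x j ^ k) M c J := by
  funext J
  rw [koszulD_apply_apply, koszulD_apply_apply, Finset.smul_sum]
  refine Finset.sum_congr rfl fun j hj => ?_
  rw [← Finset.prod_erase_mul J x hj]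
  simp only [smul_smul]
  congr 1
  ring

section Graded

variable {ℳ : ℤ → AddSubgroup M} {x : Fin r → R}

theorem prod_pow_smul_mem (hx : ∀ j n, ∀ m ∈ ℳ n, x j • m ∈ ℳ (n + 1)) (J : Finset (Fin r))
    (l : ℕ) (n : ℤ) {m : M} (hm : m ∈ ℳ n) :
    (∏ j ∈ J, x j) ^ l • m ∈ ℳ (n + l * J.card) := by
  have h1 : ∀ n, ∀ m ∈ ℳ n, (∏ j ∈ J, x j) • m ∈ ℳ (n + J.card) := by
    induction J using Finset.induction_on with
    | empty => intro n m hm; simpa using hm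
    | insert i J hi ih =>
      intro n m hm
      rw [Finset.prod_insert hi, mul_smul, Finset.card_insert_of_notMem hi, Nat.cast_succ,
        ← add_assoc]
      exact hx _ _ _ (ih n m hm)
  induction l with
  | zero => simpa using hm
  | succ l ih =>
    rw [pow_succ', mul_smul]
    convert h1 _ _ ih using 2
    push_cast; ring

theorem exists_of_mem_locDegree (hx : ∀ j n, ∀ m ∈ ℳ n, x j • m ∈ ℳ (n + 1))
    {J : Finset (Fin r)} {n : ℤ} {z : LocalizedModule (Submonoid.powers (∏ j ∈ J, x j)) M}
    (hz : z ∈ locDegree ℳ x J n) :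
    ∃ k : ℕ, ∃ m ∈ ℳ (n + k * J.card),
      z = LocalizedModule.mk m (Submonoid.pow (∏ j ∈ J, x j) k) := by
  have raise : ∀ (k l : ℕ) (m : M), m ∈ ℳ (n + k * J.card) →
      (∏ j ∈ J, x j) ^ l • m ∈ ℳ (n + (k + l : ℕ) * J.card) := fun k l m hm => by
    convert prod_pow_smul_mem hx J l _ hm using 2
    push_cast; ring
  induction hz using AddSubgroup.closure_induction with
  | mem z hz => exact hz
  | zero => exact ⟨0, 0, zero_mem _, (LocalizedModule.zero_mk _).symm⟩
  | add z w _ _ hz hw =>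
    obtain ⟨k, m, hm, rfl⟩ := hz
    obtain ⟨l, m', hm', rfl⟩ := hw
    refine ⟨k + l, _, add_mem (raise k l m hm) (add_comm l k ▸ raise l k m' hm'), ?_⟩
    rw [← mk_pow_add m _ k l, ← mk_pow_add m' _ l k, add_comm l k, LocalizedModule.mk_add_mk,
      ← smul_add, LocalizedModule.mk_cancel_common_left]
  | neg z _ hz =>
    obtain ⟨k, m, hm, rfl⟩ := hz
    exact ⟨k, -m, neg_mem hm, (LocalizedModule.mk_neg).symm⟩

theorem exists_koszulToCech_of_mem (hx : ∀ j n, ∀ m ∈ ℳ n, x j • m ∈ ℳ (n + 1))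
    {n : Finset (Fin r) → ℤ} {c : Cochain x M} (hc : ∀ J, c J ∈ locDegree ℳ x J (n J)) :
    ∃ k : ℕ, ∃ m : Finset (Fin r) → M, (∀ J, m J ∈ ℳ (n J + (k + 1 : ℕ) * J.card)) ∧
      c = koszulToCech x (k + 1) m := by
  choose k m hm h using fun J => exists_of_mem_locDegree hx (hc J)
  obtain ⟨K, hK⟩ : ∃ K, ∀ J, k J ≤ K := ⟨∑ J, k J, fun J =>
    Finset.single_le_sum (f := k) (fun _ _ => Nat.zero_le _) (Finset.mem_univ J)⟩
  refine ⟨K, fun J => (∏ j ∈ J, x j) ^ (K + 1 - k J) • m J, fun J => ?_, ?_⟩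
  · convert prod_pow_smul_mem hx J (K + 1 - k J) _ (hm J) using 2
    have := hK J
    rw [add_assoc, ← add_mul]
    congr 2
    omega
  · funext J
    have := hK J
    rw [h J, koszulToCech]
    conv_rhs => rw [← Nat.add_sub_cancel' (show k J ≤ K + 1 by omega)]
    rw [Nat.add_sub_cancel_left]
    exact (mk_pow_add _ _ _ _).symm

variable (ℳ x) in
/-- The Čech complex is exact in level `ℓ`, the sum of the cohomological and the internal degree:
the value at `J` of a cochain of level `ℓ` has degree `ℓ - #J`. -/
def CechExact (ℓ : ℤ) : Prop :=
  ∀ c : Cochain x M, (∀ J, c J ∈ locDegree ℳ x J (ℓ - J.card)) → cechD x M c = 0 →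
    ∃ b : Cochain x M, (∀ J, b J ∈ locDegree ℳ x J (ℓ - 1 - J.card)) ∧ cechD x M b = c

/-- The Čech complex is the colimit of the Koszul complexes of the powers `x_j^k`: a Čech cocycle
becomes a Koszul cocycle after raising `k`. -/
theorem cechExact_of_koszulExact (hx : ∀ j n, ∀ m ∈ ℳ n, x j • m ∈ ℳ (n + 1)) {m : ℤ}
    (h : ∀ ℓ > m, KoszulExact ℳ x ℓ) : ∀ ℓ > m, CechExact ℳ x ℓ := by
  intro ℓ hℓ c hc hdc
  obtain ⟨k, a, ha, rfl⟩ := exists_koszulToCech_of_mem hx hc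
  rw [cechD_koszulToCech] at hdc
  have hex : ∀ J, ∃ l : ℕ,
      (∏ j ∈ J, x j) ^ l • koszulD (fun j => x j ^ (k + 1)) M a J = 0 := fun J => by
    have := congrFun hdc J
    rw [koszulToCech, Pi.zero_apply, ← LocalizedModule.zero_mk 1, LocalizedModule.mk_eq] at this
    obtain ⟨⟨_, l, rfl⟩, hl⟩ := this
    rw [one_smul, smul_zero, smul_zero] at hl
    exact ⟨l, hl⟩
  choose l hl using hex
  obtain ⟨L, hL⟩ : ∃ L, ∀ J, l J ≤ L := ⟨∑ J, l J, fun J =>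
    Finset.single_le_sum (f := l) (fun _ _ => Nat.zero_le _) (Finset.mem_univ J)⟩
  have hexp : ∀ J : Finset (Fin r), ∑ _j ∈ J, ((k + L : ℕ) : ℤ) = (k + L : ℕ) * J.card :=
    fun J => by rw [Finset.sum_const, nsmul_eq_mul, mul_comm]
  obtain ⟨b, hb, hdb⟩ := koszulExactPow_of_koszulExact hx h (fun _ => k + L) ℓ hℓ
    (fun J => (∏ j ∈ J, x j) ^ L • a J) (fun J => by
      rw [hexp]
      convert prod_pow_smul_mem hx J L _ (ha J) using 2
      push_cast; ring) (by
      have := koszulD_prod_pow_smul x (k + 1) L a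
      rw [add_right_comm] at this
      rw [this]
      funext J
      rw [← Nat.sub_add_cancel (hL J), pow_add, mul_smul, hl, smul_zero]
      rfl)
  refine ⟨koszulToCech x (k + L + 1) b, fun J => ?_, ?_⟩
  · refine AddSubgroup.subset_closure ⟨k + L + 1, b J, ?_, rfl⟩
    convert hb J using 2
    rw [hexp]
    push_cast; ring
  · rw [cechD_koszulToCech, hdb, ← koszulToCech_add x (k + 1) L a, add_right_comm k L 1]

theorem cechD_cechD (c : Cochain x M) : cechD x M (cechD x M c) = 0 := by
  obtain ⟨k, m, -, rfl⟩ := exists_koszulToCech_of_mem (ℳ := fun _ => ⊤) (x := x) (n := fun _ => 0)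
    (c := c) (fun _ _ _ _ => trivial) (fun J => by
      induction c J using LocalizedModule.induction_on with
      | _ m s =>
        obtain ⟨_, k, rfl⟩ := s
        exact AddSubgroup.subset_closure ⟨k, m, trivial, rfl⟩)
  rw [cechD_koszulToCech, cechD_koszulToCech, koszulD_koszulD]
  funext J
  exact LocalizedModule.zero_mk _

end Graded

end Cech

/-! ### The Koszul–Čech double complex and regularity -/

section DoubleComplex

variable {R : Type*} [CommRing R] {M : Type*} [AddCommGroup M] [Module R M] {r s : ℕ}
  {ℳ : ℤ → AddSubgroup M} {x : Fin r → R} {y : Fin s → R}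

theorem smul_mem_locDegree (hx : ∀ j n, ∀ m ∈ ℳ n, x j • m ∈ ℳ (n + 1)) {a : R} {d : ℤ}
    (ha : ∀ n, ∀ m ∈ ℳ n, a • m ∈ ℳ (n + d)) {J : Finset (Fin r)} {n : ℤ}
    {z : LocalizedModule (Submonoid.powers (∏ j ∈ J, x j)) M} (hz : z ∈ locDegree ℳ x J n) :
    a • z ∈ locDegree ℳ x J (n + d) := by
  obtain ⟨k, m, hm, rfl⟩ := exists_of_mem_locDegree hx hz
  refine AddSubgroup.subset_closure ⟨k, a • m, ?_, LocalizedModule.smul'_mk _ _ _⟩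
  convert ha _ _ hm using 2
  ring

/-- Division by `x_j` is possible in `M_{x_J}` for `j ∈ J`, and lowers the degree by one. -/
theorem exists_smul_eq_of_mem_locDegree (hx : ∀ j n, ∀ m ∈ ℳ n, x j • m ∈ ℳ (n + 1))
    {J : Finset (Fin r)} {j : Fin r} (hj : j ∈ J) {n : ℤ}
    {z : LocalizedModule (Submonoid.powers (∏ j ∈ J, x j)) M} (hz : z ∈ locDegree ℳ x J n) :
    ∃ w ∈ locDegree ℳ x J (n - 1), x j • w = z := by
  obtain ⟨k, m, hm, rfl⟩ := exists_of_mem_locDegree hx hz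
  refine ⟨_, AddSubgroup.subset_closure ⟨k + 1, (∏ i ∈ J.erase j, x i) • m, ?_, rfl⟩, ?_⟩
  · have := prod_pow_smul_mem hx (J.erase j) 1 _ hm
    rw [pow_one, Finset.card_erase_of_mem hj,
      Nat.cast_pred (Finset.card_pos.mpr ⟨j, hj⟩)] at this
    convert this using 2
    push_cast; ring
  · rw [LocalizedModule.smul'_mk, smul_smul, Finset.mul_prod_erase J x hj]
    have := mk_pow_add m (∏ i ∈ J, x i) k 1
    rwa [pow_one] at this

theorem smul_injective_of_mem {J : Finset (Fin r)} {j : Fin r} (hj : j ∈ J) :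
    Function.Injective
      (fun z : LocalizedModule (Submonoid.powers (∏ j ∈ J, x j)) M => x j • z) := by
  have := isUnit_algebraMap_end_of_dvd (M := M) (Finset.dvd_prod_of_mem x hj)
    ⟨x j, Submonoid.mem_powers _⟩
  rw [Module.End.isUnit_iff] at this
  exact this.injective

/-- The Koszul complex of `y` on `M_{x_J}` is exact in all degrees if `J ≠ ∅` and the `x_j` are
combinations of the `y_i`: then `y` generates the unit ideal of the localization. -/
theorem koszulExact_locDegree (hx : ∀ j n, ∀ m ∈ ℳ n, x j • m ∈ ℳ (n + 1))
    {a : Fin r → Fin s → R} (ha : ∀ j i n, ∀ m ∈ ℳ n, a j i • m ∈ ℳ n)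
    (hxy : ∀ j, x j = ∑ i, a j i * y i) {J : Finset (Fin r)} (hJ : J.Nonempty) (ℓ : ℤ) :
    KoszulExact (fun n => locDegree ℳ x J n) y ℓ := by
  intro c hc hdc
  obtain ⟨j, hj⟩ := hJ
  choose w hw hwc using fun I => exists_smul_eq_of_mem_locDegree hx hj (hc I)
  have hdw : koszulD y _ w = 0 := by
    funext I
    apply smul_injective_of_mem hj
    have h1 : x j • w = c := funext hwc
    have h2 : x j • koszulD y _ w = 0 := by rw [← map_smul, h1, hdc]
    simpa using congrFun h2 I
  refine ⟨∑ i, a j i • contract (R := R) i w, fun I => ?_, ?_⟩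
  · rw [Finset.sum_apply]
    refine sum_mem fun i _ => ?_
    rw [Pi.smul_apply, contract_apply]
    have hmem : ∀ I, a j i • w I ∈ locDegree ℳ x J (ℓ - 1) := fun I => by
      have := smul_mem_locDegree hx (d := 0) (fun n m hm => by simpa using ha j i n m hm) (hw I)
      rwa [add_zero] at this
    split_ifs
    · rw [smul_zero]; exact zero_mem _
    · rcases neg_one_pow_eq_or R (I.filter (· < i)).card with h4 | h4
      · rw [koszulSign, h4, one_smul]; exact hmem _
      · rw [koszulSign, h4, neg_smul, one_smul, smul_neg]; exact neg_mem (hmem _)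
  · have := koszulD_contract_add y (a j) w
    rw [hdw] at this
    simp only [map_zero, smul_zero, Finset.sum_const_zero, add_zero] at this
    rw [this, ← hxy]
    exact funext hwc

theorem res_mem_locDegree (hx : ∀ j n, ∀ m ∈ ℳ n, x j • m ∈ ℳ (n + 1)) {J : Finset (Fin r)}
    {j : Fin r} (hj : j ∈ J) {n : ℤ}
    {z : LocalizedModule (Submonoid.powers (∏ i ∈ J.erase j, x i)) M}
    (hz : z ∈ locDegree ℳ x (J.erase j) n) :
    res M (Finset.prod_dvd_prod_of_subset (J.erase j) J x (Finset.erase_subset j J)) z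
      ∈ locDegree ℳ x J n := by
  obtain ⟨k, m, hm, rfl⟩ := exists_of_mem_locDegree hx hz
  rw [res_mk _ (c := x j) (Finset.prod_erase_mul J x hj).symm]
  refine AddSubgroup.subset_closure ⟨k, _, ?_, rfl⟩
  have := smul_pow_mem (hx j) k _ hm
  rw [Finset.card_erase_of_mem hj, Nat.cast_pred (Finset.card_pos.mpr ⟨j, hj⟩)] at this
  convert this using 2
  ring

theorem koszulSign_smul_mem {N : Type*} [AddCommGroup N] [Module R N] (H : AddSubgroup N)
    (j : Fin r) (J : Finset (Fin r)) {z : N} (hz : z ∈ H) : koszulSign R j J • z ∈ H := by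
  rcases neg_one_pow_eq_or R (J.filter (· < j)).card with h | h
  · rw [koszulSign, h, one_smul]; exact hz
  · rw [koszulSign, h, neg_smul, one_smul]; exact neg_mem hz

variable (x y M) in
/-- The total differential of the double complex formed by the Koszul complex of `y` and the Čech
complex of `x`; its cochains are the Koszul cochains with values in the Čech cochains. -/
noncomputable def totalD :
    (Finset (Fin s) → Cochain x M) →ₗ[R] (Finset (Fin s) → Cochain x M) :=
  koszulD y (Cochain x M) +
    LinearMap.pi fun I => (-1 : R) ^ I.card • cechD x M ∘ₗ LinearMap.proj I

theorem totalD_apply (t : Finset (Fin s) → Cochain x M) (I : Finset (Fin s)) :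
    totalD M x y t I = koszulD y (Cochain x M) t I + (-1 : R) ^ I.card • cechD x M (t I) := by
  simp [totalD]

theorem totalD_totalD (t : Finset (Fin s) → Cochain x M) :
    totalD M x y (totalD M x y t) = 0 := by
  funext I
  have h1 : totalD M x y t = koszulD y (Cochain x M) t
      + fun I => (-1 : R) ^ I.card • cechD x M (t I) := funext fun I => totalD_apply t I
  have h2 : koszulD y (Cochain x M) (fun I => (-1 : R) ^ I.card • cechD x M (t I)) I
      = -((-1 : R) ^ I.card • cechD x M (koszulD y (Cochain x M) t I)) := by
    rw [koszulD_apply_apply, koszulD_apply_apply, map_sum, Finset.smul_sum,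
      ← Finset.sum_neg_distrib]
    refine Finset.sum_congr rfl fun i hi => ?_
    rw [← Finset.card_erase_add_one hi, pow_succ, map_smul, map_smul]
    module
  rw [totalD_apply, h1, map_add, koszulD_koszulD, zero_add, h2, Pi.add_apply, map_add, map_smul,
    cechD_cechD]
  simp

variable (ℳ x) in
/-- A cochain of the double complex has level `ℓ` if its value at `(I, J)` has degree
`ℓ - #J`. -/
def HasLevel (ℓ : ℤ) (t : Finset (Fin s) → Cochain x M) : Prop :=
  ∀ I J, t I J ∈ locDegree ℳ x J (ℓ - J.card)

theorem HasLevel.totalD (hx : ∀ j n, ∀ m ∈ ℳ n, x j • m ∈ ℳ (n + 1))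
    (hy : ∀ i n, ∀ m ∈ ℳ n, y i • m ∈ ℳ (n + 1)) {ℓ : ℤ}
    {t : Finset (Fin s) → Cochain x M} (ht : HasLevel ℳ x ℓ t) :
    HasLevel ℳ x (ℓ + 1) (totalD M x y t) := by
  intro I J
  rw [totalD_apply, Pi.add_apply]
  refine add_mem ?_ ?_
  · rw [koszulD_apply_apply, Finset.sum_apply]
    refine sum_mem fun i _ => ?_
    have := smul_mem_locDegree hx (hy i) (koszulSign_smul_mem (R := R) _ i I (ht (I.erase i) J))
    rw [show ℓ + 1 - (J.card : ℤ) = ℓ - J.card + 1 by ring]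
    exact this
  · have h1 : cechD x M (t I) J ∈ locDegree ℳ x J (ℓ + 1 - J.card) := by
      rw [cechD_apply]
      refine sum_mem fun j hj => koszulSign_smul_mem _ _ _ ?_
      have := res_mem_locDegree hx hj (ht I (J.erase j))
      rw [Finset.card_erase_of_mem hj, Nat.cast_pred (Finset.card_pos.mpr ⟨j, hj⟩)] at this
      convert this using 2
      ring
    rw [Pi.smul_apply]
    rcases neg_one_pow_eq_or R I.card with h | h
    · rw [h, one_smul]; exact h1
    · rw [h, neg_smul, one_smul]; exact neg_mem h1

theorem HasLevel.sub {ℓ : ℤ} {t u : Finset (Fin s) → Cochain x M} (ht : HasLevel ℳ x ℓ t)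
    (hu : HasLevel ℳ x ℓ u) : HasLevel ℳ x ℓ (t - u) :=
  fun I J => sub_mem (ht I J) (hu I J)

theorem HasLevel.add {ℓ : ℤ} {t u : Finset (Fin s) → Cochain x M} (ht : HasLevel ℳ x ℓ t)
    (hu : HasLevel ℳ x ℓ u) : HasLevel ℳ x ℓ (t + u) :=
  fun I J => add_mem (ht I J) (hu I J)

theorem koszulD_apply_proj (t : Finset (Fin s) → Cochain x M) (I : Finset (Fin s))
    (J : Finset (Fin r)) :
    koszulD y (Cochain x M) t I J = koszulD y _ (fun I => t I J) I :=
  (congrFun (koszulD_map (LinearMap.proj (R := R)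
    (φ := fun J => LocalizedModule (Submonoid.powers (∏ j ∈ J, x j)) M) J) y t) I).symm

/-- The part of the double complex with `#J ≥ p ≥ 1` is exact, by exactness of the Koszul complex
on the localizations. -/
theorem exists_totalD_eq_of_vanish (hx : ∀ j n, ∀ m ∈ ℳ n, x j • m ∈ ℳ (n + 1))
    (hy : ∀ i n, ∀ m ∈ ℳ n, y i • m ∈ ℳ (n + 1))
    {a : Fin r → Fin s → R} (ha : ∀ j i n, ∀ m ∈ ℳ n, a j i • m ∈ ℳ n)
    (hxy : ∀ j, x j = ∑ i, a j i * y i) (ℓ : ℤ) (k p : ℕ) (hp : 1 ≤ p) (hk : r < p + k)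
    (t : Finset (Fin s) → Cochain x M) (ht : HasLevel ℳ x ℓ t) (hdt : totalD M x y t = 0)
    (htp : ∀ I J, J.card < p → t I J = 0) :
    ∃ u : Finset (Fin s) → Cochain x M, HasLevel ℳ x (ℓ - 1) u ∧ (∀ I, u I ∅ = 0) ∧
      totalD M x y u = t := by
  induction k generalizing p t with
  | zero =>
    refine ⟨0, fun _ _ => zero_mem _, fun _ => rfl, ?_⟩
    rw [map_zero]
    funext I J
    exact (htp I J (by have := card_finset_fin_le J; omega)).symm
  | succ k ih =>
    have hcech : ∀ (t : Finset (Fin s) → Cochain x M), (∀ I J, J.card < p → t I J = 0) →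
        ∀ I J, J.card ≤ p → cechD x M (t I) J = 0 := fun t htp I J hJ => by
      rw [cechD_apply]
      refine Finset.sum_eq_zero fun j hj => ?_
      rw [htp _ _ (by
        have := Finset.card_erase_add_one hj
        omega), map_zero, smul_zero]
    have hex : ∀ J : Finset (Fin r), ∃ b : Finset (Fin s) →
        LocalizedModule (Submonoid.powers (∏ j ∈ J, x j)) M,
        (∀ I, b I ∈ locDegree ℳ x J (ℓ - 1 - J.card)) ∧
        (J.card = p → koszulD y _ b = fun I => t I J) ∧ (J.card ≠ p → b = 0) := fun J => by
      by_cases hJ : J.card = p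
      · obtain ⟨b, hb, hdb⟩ := koszulExact_locDegree hx ha hxy
          (Finset.card_pos.mp (by omega : 0 < J.card)) (ℓ - J.card) (fun I => t I J)
          (fun I => ht I J) (by
            funext I
            have := congrFun (congrFun hdt I) J
            rw [totalD_apply, Pi.add_apply, Pi.smul_apply, hcech t htp I J hJ.le, smul_zero,
              add_zero, koszulD_apply_proj] at this
            exact this)
        refine ⟨b, fun I => ?_, fun _ => hdb, fun h => absurd hJ h⟩
        rw [sub_right_comm]
        exact hb I
      · exact ⟨0, fun _ => zero_mem _, fun h => absurd h hJ, fun _ => rfl⟩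
    choose b hb hdb hb0 using hex
    have hu0 : ∀ I J, J.card < p → b J I = 0 := fun I J hJ => by
      rw [hb0 J hJ.ne]; rfl
    have hlev : HasLevel ℳ x (ℓ - 1) (fun I J => b J I) := fun I J => hb J I
    obtain ⟨u, hu, hu1, hdu⟩ := ih (p + 1) (by omega) (by omega)
      (t - totalD M x y fun I J => b J I)
      (ht.sub (by simpa using hlev.totalD hx hy))
      (by rw [map_sub, hdt, totalD_totalD, sub_zero]) (fun I J hJ => by
        rw [Pi.sub_apply, Pi.sub_apply, totalD_apply, Pi.add_apply, Pi.smul_apply,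
          hcech _ hu0 I J (by omega), smul_zero, add_zero, koszulD_apply_proj]
        by_cases hJp : J.card = p
        · rw [hdb J hJp, sub_self]
        · rw [show (fun I => b J I) = 0 from hb0 J hJp, map_zero, htp I J (by omega)]
          simp)
    refine ⟨(fun I J => b J I) + u, hlev.add hu, fun I => ?_, ?_⟩
    · rw [Pi.add_apply, Pi.add_apply, hu1, add_zero]
      exact hu0 I ∅ (by rw [Finset.card_empty]; omega)
    · rw [map_add, hdu, add_sub_cancel]

/-- The double complex is exact in level `ℓ` if the Čech complex is. -/
theorem exists_totalD_eq_of_cechExact (hx : ∀ j n, ∀ m ∈ ℳ n, x j • m ∈ ℳ (n + 1))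
    (hy : ∀ i n, ∀ m ∈ ℳ n, y i • m ∈ ℳ (n + 1)) {ℓ : ℤ} (hC : CechExact ℳ x ℓ)
    (k p : ℕ) (hk : s < p + k)
    (t : Finset (Fin s) → Cochain x M) (ht : HasLevel ℳ x ℓ t) (hdt : totalD M x y t = 0)
    (htp : ∀ I, I.card < p → t I = 0) :
    ∃ u : Finset (Fin s) → Cochain x M, HasLevel ℳ x (ℓ - 1) u ∧ totalD M x y u = t := by
  induction k generalizing p t with
  | zero =>
    refine ⟨0, fun _ _ => zero_mem _, ?_⟩
    rw [map_zero]
    funext I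
    exact (htp I (by have := card_finset_fin_le I; omega)).symm
  | succ k ih =>
    have hkos : ∀ (t : Finset (Fin s) → Cochain x M), (∀ I, I.card < p → t I = 0) →
        ∀ I, I.card ≤ p → koszulD y _ t I = 0 := fun t htp I hI => by
      rw [koszulD_apply_apply]
      refine Finset.sum_eq_zero fun i hi => ?_
      rw [htp _ (by
        have := Finset.card_erase_add_one hi
        omega), smul_zero, smul_zero]
    have hsign : ∀ I : Finset (Fin s), (-1 : R) ^ I.card * (-1) ^ I.card = 1 := fun I => by
      rw [← pow_add, ← two_mul, pow_mul]; simp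
    have hex : ∀ I : Finset (Fin s), ∃ b : Cochain x M,
        (∀ J, b J ∈ locDegree ℳ x J (ℓ - 1 - J.card)) ∧
        (I.card = p → (-1 : R) ^ I.card • cechD x M b = t I) ∧ (I.card ≠ p → b = 0) := fun I => by
      by_cases hI : I.card = p
      · obtain ⟨b, hb, hdb⟩ := hC (t I) (fun J => ht I J) (by
            have := congrFun hdt I
            rw [totalD_apply, hkos t htp I hI.le, zero_add] at this
            have h2 := congrArg (fun z => (-1 : R) ^ I.card • z) this
            simp only [smul_smul, hsign, one_smul] at h2
            rw [h2]
            exact smul_zero _)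
        refine ⟨(-1 : R) ^ I.card • b, fun J => ?_, fun _ => ?_, fun h => absurd hI h⟩
        · rw [Pi.smul_apply]
          rcases neg_one_pow_eq_or R I.card with h | h
          · rw [h, one_smul]; exact hb J
          · rw [h, neg_smul, one_smul]; exact neg_mem (hb J)
        · rw [map_smul, smul_smul, hsign, one_smul, hdb]
      · exact ⟨0, fun _ => zero_mem _, fun h => absurd h hI, fun _ => rfl⟩
    choose b hb hdb hb0 using hex
    have hu0 : ∀ I, I.card < p → b I = 0 := fun I hI => hb0 I hI.ne
    obtain ⟨u, hu, hdu⟩ := ih (p + 1) (by omega) (t - totalD M x y b)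
      (ht.sub (by simpa using HasLevel.totalD (y := y) hx hy (ℓ := ℓ - 1) (t := b) hb))
      (by rw [map_sub, hdt, totalD_totalD, sub_zero]) (fun I hI => by
        rw [Pi.sub_apply, totalD_apply, hkos _ hu0 I (by omega), zero_add]
        by_cases hIp : I.card = p
        · rw [hdb I hIp, sub_self]
        · rw [hb0 I hIp, map_zero, htp I (by omega), smul_zero, sub_zero])
    refine ⟨b + u, HasLevel.add hb hu, ?_⟩
    rw [map_add, hdu, add_sub_cancel]

/-- Exactness of the Čech complex of `x` in the levels above `m` implies exactness of the Koszul
complex of `y` in these levels, if the `x_j` are combinations of the `y_i` with coefficients of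
degree zero. -/
theorem koszulExact_of_cechExact (hx : ∀ j n, ∀ m ∈ ℳ n, x j • m ∈ ℳ (n + 1))
    (hy : ∀ i n, ∀ m ∈ ℳ n, y i • m ∈ ℳ (n + 1))
    {a : Fin r → Fin s → R} (ha : ∀ j i n, ∀ m ∈ ℳ n, a j i • m ∈ ℳ n)
    (hxy : ∀ j, x j = ∑ i, a j i * y i) {ℓ : ℤ} (h : CechExact ℳ x ℓ) :
    KoszulExact ℳ y ℓ := by
  intro z hz hdz
  let ι : M →ₗ[R] Cochain x M :=
    LinearMap.single R (fun J => LocalizedModule (Submonoid.powers (∏ j ∈ J, x j)) M) ∅ ∘ₗ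
      LocalizedModule.mkLinearMap (Submonoid.powers (∏ j ∈ ∅, x j)) M
  have hι : ∀ m, ι m ∅ = LocalizedModule.mk m 1 := fun m =>
    Pi.single_eq_same (M := fun J => LocalizedModule (Submonoid.powers (∏ j ∈ J, x j)) M) ∅ _
  have hι' : ∀ m J, J ≠ ∅ → ι m J = 0 := fun m J hJ =>
    Pi.single_eq_of_ne (M := fun J => LocalizedModule (Submonoid.powers (∏ j ∈ J, x j)) M) hJ _
  have ht0 : HasLevel ℳ x ℓ (fun I => ι (z I)) := fun I J => by
    by_cases hJ : J = ∅
    · subst hJ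
      change ι (z I) ∅ ∈ _
      rw [hι]
      refine AddSubgroup.subset_closure ⟨0, z I, by simpa using hz I, ?_⟩
      congr 1
      ext
      simp
    · change ι (z I) J ∈ _
      rw [hι' _ _ hJ]; exact zero_mem _
  -- `z` is a cocycle of the double complex up to a cochain `t'` without component at `J = ∅`
  obtain ⟨t', ht', ht'0, hdt'⟩ := exists_totalD_eq_of_vanish (y := y) hx hy ha hxy (ℓ + 1) r 1
    le_rfl (by omega) (totalD M x y fun I => ι (z I)) (ht0.totalD hx hy) (totalD_totalD _)
    (fun I J hJ => by
      have : J = ∅ := by simpa using hJ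
      subst this
      rw [totalD_apply, koszulD_map, hdz, Pi.add_apply, Pi.smul_apply, cechD_apply,
        Finset.sum_empty, smul_zero, add_zero]
      exact congrFun (map_zero ι) ∅)
  rw [add_sub_cancel_right] at ht'
  obtain ⟨u, hu, hdu⟩ := exists_totalD_eq_of_cechExact (y := y) hx hy h (s + 1) 0 (by omega)
    ((fun I => ι (z I)) - t') (ht0.sub ht') (by rw [map_sub, hdt', sub_self])
    (fun I hI => absurd hI (Nat.not_lt_zero _))
  -- the part at `J = ∅` of the double complex is the Koszul complex of `y` on `M`
  have hex : ∀ I, ∃ m ∈ ℳ (ℓ - 1), u I ∅ = LocalizedModule.mk m 1 := fun I => by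
    obtain ⟨k, m, hm, he⟩ := exists_of_mem_locDegree hx (hu I ∅)
    refine ⟨m, by simpa using hm, ?_⟩
    rw [he]
    congr 1
    ext
    simp
  choose b hb hub using hex
  refine ⟨b, hb, funext fun I => ?_⟩
  have h1 := congrFun (congrFun hdu I) ∅
  rw [totalD_apply, Pi.add_apply, Pi.smul_apply, cechD_apply, Finset.sum_empty, smul_zero,
    add_zero, koszulD_apply_proj, Pi.sub_apply, Pi.sub_apply, ht'0, sub_zero, hι] at h1
  have h2 : (fun I => u I ∅)
      = fun I => LocalizedModule.mkLinearMap (Submonoid.powers (∏ j ∈ ∅, x j)) M (b I) :=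
    funext hub
  rw [h2, koszulD_map] at h1
  beta_reduce at h1
  rw [LocalizedModule.mkLinearMap_apply, LocalizedModule.mk_eq] at h1
  obtain ⟨⟨_, k, rfl⟩, hk⟩ := h1
  rw [one_smul, one_smul, Submonoid.smul_def, Submonoid.smul_def] at hk
  simpa using hk

end DoubleComplex

section Regularity

variable {R : Type*} [CommRing R] {M : Type*} [AddCommGroup M] [Module R M] {r : ℕ}
  {ℳ : ℤ → AddSubgroup M} {x : Fin r → R}

theorem subsingleton_localCohomology_iff (p : ℕ) (n : ℤ) :
    Subsingleton (LocalCohomology ℳ x p n) ↔ cocycles ℳ x p n ≤ coboundaries ℳ x p n := by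
  rw [← AddSubgroup.addSubgroupOf_eq_top]
  constructor
  · intro h
    exact QuotientAddGroup.addSubgroup_eq_top_of_subsingleton _ h
  · intro h
    rw [LocalCohomology, h]
    exact QuotientAddGroup.subsingleton_quotient_top

/-- A cochain of level `ℓ` is the sum of its components of cohomological degree `p`, which have
internal degree `ℓ - p`. -/
theorem cechExact_iff (ℓ : ℤ) :
    CechExact ℳ x ℓ ↔ ∀ (p : ℕ) (n : ℤ), n + p = ℓ → Subsingleton (LocalCohomology ℳ x p n) := by
  simp only [subsingleton_localCohomology_iff]
  constructor
  · rintro h p n rfl c ⟨hc, hdc⟩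
    obtain ⟨b, hb, hdb⟩ := h c (fun J => by
      by_cases hJ : J.card = p
      · rw [hJ, add_sub_cancel_right]; exact (hc J).1
      · rw [(hc J).2 hJ]; exact zero_mem _) hdc
    cases p with
    | zero =>
      rw [coboundaries, AddSubgroup.mem_bot]
      funext J
      by_cases hJ : J.card = 0
      · rw [Finset.card_eq_zero] at hJ
        subst hJ
        rw [← hdb, cechD_apply, Finset.sum_empty, Pi.zero_apply]
      · exact (hc J).2 hJ
    | succ p =>
      refine ⟨fun J => if J.card = p then b J else 0, fun J => ⟨?_, fun hJ => if_neg hJ⟩, ?_⟩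
      · beta_reduce
        split_ifs with hJ
        · have := hb J
          rw [hJ] at this
          convert this using 2
          push_cast; ring
        · exact zero_mem _
      · change cechD x M _ = c
        funext J
        by_cases hJ : J.card = p + 1
        · rw [← hdb, cechD_apply, cechD_apply]
          refine Finset.sum_congr rfl fun j hj => ?_
          rw [if_pos (by rw [Finset.card_erase_of_mem hj, hJ, Nat.add_sub_cancel])]
        · rw [(hc J).2 hJ, cechD_apply]
          refine Finset.sum_eq_zero fun j hj => ?_
          rw [if_neg (by
            have := Finset.card_erase_add_one hj
            omega), map_zero, smul_zero]
  · intro h c hc hdc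
    -- the components of `c` in the single cohomological degrees are cocycles
    have key : ∀ p : ℕ, ∃ b : Cochain x M, (∀ J, b J ∈ locDegree ℳ x J (ℓ - 1 - J.card)) ∧
        ∀ J, J.card = p → cechD x M b J = c J := fun p => by
      have hmem := h p (ℓ - p) (by ring) (x := fun J => if J.card = p then c J else 0)
        ⟨fun J => ⟨by
          beta_reduce
          split_ifs with hJ
          · rw [← hJ]; exact hc J
          · exact zero_mem _, fun hJ => if_neg hJ⟩, by
          change cechD x M _ = 0
          funext J
          by_cases hJ : J.card = p + 1
          · rw [← hdc, cechD_apply, cechD_apply]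
            refine Finset.sum_congr rfl fun j hj => ?_
            rw [if_pos (by rw [Finset.card_erase_of_mem hj, hJ, Nat.add_sub_cancel])]
          · rw [cechD_apply]
            refine Finset.sum_eq_zero fun j hj => ?_
            rw [if_neg (by
              have := Finset.card_erase_add_one hj
              omega), map_zero, smul_zero]⟩
      cases p with
      | zero =>
        refine ⟨0, fun J => zero_mem _, fun J hJ => ?_⟩
        rw [coboundaries, AddSubgroup.mem_bot] at hmem
        have := congrFun hmem J
        rw [if_pos hJ] at this
        rw [map_zero, this]
      | succ p =>
        obtain ⟨b, hb, hdb⟩ := hmem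
        refine ⟨b, fun J => ?_, fun J hJ => ?_⟩
        · by_cases hJ : J.card = p
          · have := (hb J).1
            rw [hJ]
            convert this using 2
            push_cast; ring
          · rw [(hb J).2 hJ]; exact zero_mem _
        · have := congrFun hdb J
          rw [if_pos hJ] at this
          exact this
    choose b hb hdb using key
    refine ⟨fun J => b (J.card + 1) J, fun J => hb _ J, funext fun J => ?_⟩
    rw [← hdb _ J rfl, cechD_apply, cechD_apply]
    refine Finset.sum_congr rfl fun j hj => ?_
    rw [Finset.card_erase_add_one hj]

theorem add_coe_le_coe_iff (a : WithBot (WithTop ℤ)) (p N : ℤ) :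
    a + ((p : WithTop ℤ) : WithBot (WithTop ℤ)) ≤ ((N : WithTop ℤ) : WithBot (WithTop ℤ)) ↔
      a ≤ (((N - p : ℤ) : WithTop ℤ) : WithBot (WithTop ℤ)) := by
  induction a using WithBot.recBotCoe with
  | bot => simp
  | coe a =>
    induction a using WithTop.recTopCoe with
    | top =>
      rw [← WithBot.coe_add, WithBot.coe_le_coe, WithBot.coe_le_coe, top_add, top_le_iff,
        top_le_iff]
      simp
    | coe a =>
      rw [← WithBot.coe_add, ← WithTop.coe_add, WithBot.coe_le_coe, WithBot.coe_le_coe,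
        WithTop.coe_le_coe, WithTop.coe_le_coe]
      exact le_sub_iff_add_le.symm

theorem regularity_le_iff (N : ℤ) :
    regularity ℳ x ≤ ((N : WithTop ℤ) : WithBot (WithTop ℤ)) ↔ ∀ ℓ > N, CechExact ℳ x ℓ := by
  simp only [regularity, iSup_le_iff, add_coe_le_coe_iff, aInvariant, WithBot.coe_le_coe,
    WithTop.coe_le_coe, cechExact_iff]
  constructor
  · rintro h ℓ hℓ p n rfl
    rw [← not_nontrivial_iff_subsingleton]
    intro hn
    have := h p n hn
    omega
  · intro h p n hn
    by_contra hlt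
    rw [← not_subsingleton_iff_nontrivial] at hn
    exact hn (h (n + p) (by omega) p n rfl)

theorem exists_regularity_eq {N : ℤ} (h : ∀ ℓ > N, CechExact ℳ x ℓ)
    (h0 : ∃ ℓ ≥ 0, ¬ CechExact ℳ x ℓ) :
    ∃ m : ℕ, regularity ℳ x = (((m : ℤ) : WithTop ℤ) : WithBot (WithTop ℤ)) := by
  have h1 := (regularity_le_iff N).mpr h
  have h2 : ¬ regularity ℳ x ≤ (((-1 : ℤ) : WithTop ℤ) : WithBot (WithTop ℤ)) := fun hle => by
    obtain ⟨ℓ, hℓ, hne⟩ := h0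
    exact hne ((regularity_le_iff (-1)).mp hle ℓ (by omega))
  generalize regularity ℳ x = a at h1 h2
  induction a using WithBot.recBotCoe with
  | bot => simp at h2
  | coe a =>
    induction a using WithTop.recTopCoe with
    | top => rw [WithBot.coe_le_coe, top_le_iff] at h1; simp at h1
    | coe a =>
      rw [WithBot.coe_le_coe, WithTop.coe_le_coe] at h2
      exact ⟨a.toNat, by rw [Int.toNat_of_nonneg (by omega)]⟩

end Regularity

/-! ### Koszul exactness of the associated graded ring -/

section GradedRing

variable {A : Type*} [CommRing A] (I : Ideal A)

/-- The map `I^n → gr_I(A)_n`. -/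
noncomputable def toGr (n : ℕ) : ↥(I ^ n) →ₗ[A] Gr I where
  toFun a := Ideal.Quotient.mk _
    ⟨Polynomial.monomial n (a : A), reesAlgebra.monomial_mem.mpr a.2⟩
  map_add' a b := by
    rw [← map_add]
    congr 1
    ext1
    simp
  map_smul' t a := by
    rw [RingHom.id_apply, ← Ideal.Quotient.mkₐ_eq_mk A, ← map_smul]
    congr 1
    ext1
    simp [Polynomial.smul_monomial]

theorem coeff_mem_of_mem_map {f : reesAlgebra I}
    (hf : f ∈ I.map (algebraMap A (reesAlgebra I))) (n : ℕ) :
    (f : Polynomial A).coeff n ∈ I ^ (n + 1) := by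
  induction hf using Submodule.span_induction generalizing n with
  | mem f hf =>
    obtain ⟨b, hb, rfl⟩ := hf
    change (Polynomial.C b).coeff n ∈ _
    rw [Polynomial.coeff_C]
    split_ifs with h
    · subst h; simpa using hb
    · exact zero_mem _
  | zero => simp
  | add f g _ _ hf hg => simpa using add_mem (hf n) (hg n)
  | smul g f _ hf =>
    change ((g : Polynomial A) * (f : Polynomial A)).coeff n ∈ _
    rw [Polynomial.coeff_mul]
    refine sum_mem fun p hp => ?_
    rw [Finset.HasAntidiagonal.mem_antidiagonal] at hp
    rw [← hp, add_assoc, pow_add]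
    exact Ideal.mul_mem_mul (g.2 p.1) (hf p.2)

theorem toGr_eq_zero_iff (n : ℕ) (a : ↥(I ^ n)) : toGr I n a = 0 ↔ (a : A) ∈ I ^ (n + 1) := by
  change Ideal.Quotient.mk _ _ = 0 ↔ _
  rw [Ideal.Quotient.eq_zero_iff_mem]
  constructor
  · intro h
    simpa using coeff_mem_of_mem_map I h n
  · obtain ⟨a, ha⟩ := a
    intro h
    change a ∈ _ at h
    suffices H : ∀ a ∈ I * I ^ n, ∃ ha : a ∈ I ^ n,
        (⟨Polynomial.monomial n a, reesAlgebra.monomial_mem.mpr ha⟩ : reesAlgebra I)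
          ∈ I.map (algebraMap A (reesAlgebra I)) from (H a (by rwa [← pow_succ'])).2
    intro a ha
    induction ha using Submodule.mul_induction_on' with
    | mem_mul_mem b hb c hc =>
      refine ⟨Ideal.mul_mem_left _ _ hc, ?_⟩
      have := Ideal.mul_mem_right
        (⟨Polynomial.monomial n c, reesAlgebra.monomial_mem.mpr hc⟩ : reesAlgebra I) _
        (Ideal.mem_map_of_mem (algebraMap A (reesAlgebra I)) hb)
      convert this using 1
      ext1
      exact (Polynomial.C_mul_monomial).symm
    | add b _ c _ hb hc =>
      obtain ⟨hb1, hb2⟩ := hb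
      obtain ⟨hc1, hc2⟩ := hc
      refine ⟨add_mem hb1 hc1, ?_⟩
      convert add_mem hb2 hc2 using 1
      ext1
      simp

theorem toGr_mem (n : ℕ) (a : ↥(I ^ n)) : toGr I n a ∈ grComponent I n := by
  refine ⟨⟨Polynomial.monomial n (a : A), reesAlgebra.monomial_mem.mpr a.2⟩, fun j hj => ?_, rfl⟩
  exact Polynomial.coeff_monomial_of_ne _ (by simpa using hj)

theorem range_toGr (n : ℕ) : LinearMap.range (toGr I n) = grComponent I n := by
  apply le_antisymm
  · rintro _ ⟨a, rfl⟩
    exact toGr_mem I n a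
  · rintro _ ⟨f, hf, rfl⟩
    refine ⟨⟨(f : Polynomial A).coeff n, f.2 n⟩, ?_⟩
    change Ideal.Quotient.mk _ _ = Ideal.Quotient.mk _ f
    congr 1
    ext1
    ext j
    rw [Polynomial.coeff_monomial]
    split_ifs with h
    · rw [h]
    · exact (hf j (by simpa using Ne.symm h)).symm

theorem exists_toGr_eq {n : ℕ} {z : Gr I} (hz : z ∈ grComponent I n) : ∃ a, toGr I n a = z := by
  rwa [← range_toGr] at hz

theorem grComponent_eq_bot_of_neg {n : ℤ} (hn : n < 0) : grComponent I n = ⊥ := by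
  rw [eq_bot_iff]
  rintro _ ⟨f, hf, rfl⟩
  have : f = 0 := by
    ext1
    ext j
    exact hf j (by lia)
  rw [this, map_zero]
  exact zero_mem _

variable {I}

theorem grDegreeOne_eq (b : I) :
    grDegreeOne I b = toGr I 1 ⟨(b : A), by rw [pow_one]; exact b.2⟩ := rfl

theorem grDegreeOne_mul_toGr (b : I) (n : ℕ) (a : ↥(I ^ n)) :
    grDegreeOne I b * toGr I n a
      = toGr I (n + 1) ⟨b * a, by rw [pow_succ']; exact Ideal.mul_mem_mul b.2 a.2⟩ := by
  change Ideal.Quotient.mk _ _ * Ideal.Quotient.mk _ _ = Ideal.Quotient.mk _ _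
  rw [← map_mul]
  congr 1
  ext1
  change Polynomial.monomial 1 (b : A) * Polynomial.monomial n (a : A) = _
  rw [Polynomial.monomial_mul_monomial, add_comm]

theorem grDegreeOne_mul_mem (b : I) (n : ℤ) {z : Gr I} (hz : z ∈ grComponent I n) :
    grDegreeOne I b * z ∈ grComponent I (n + 1) := by
  rcases lt_or_ge n 0 with hn | hn
  · rw [grComponent_eq_bot_of_neg I hn, Submodule.mem_bot] at hz
    rw [hz, mul_zero]
    exact zero_mem _
  · obtain ⟨n, rfl⟩ := Int.eq_ofNat_of_zero_le hn
    obtain ⟨a, rfl⟩ := exists_toGr_eq I hz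
    rw [grDegreeOne_mul_toGr]
    exact toGr_mem I (n + 1) _

variable {r : ℕ}

theorem koszulD_mem {a : Fin r → A} (ha : ∀ j, a j ∈ I) {n : ℕ} {c : Finset (Fin r) → A}
    (hc : ∀ J, c J ∈ I ^ n) (J : Finset (Fin r)) : koszulD a A c J ∈ I ^ (n + 1) := by
  rw [koszulD_apply_apply]
  refine sum_mem fun j _ => ?_
  rw [pow_succ', smul_eq_mul]
  exact Ideal.mul_mem_mul (ha j) (Ideal.mul_mem_left _ _ (hc _))

theorem koszulD_toGr (a : Fin r → I) (n : ℕ) (c : Finset (Fin r) → ↥(I ^ n))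
    (J : Finset (Fin r)) :
    koszulD (fun j => grDegreeOne I (a j)) (Gr I) (fun J => toGr I n (c J)) J
      = toGr I (n + 1) ⟨koszulD (fun j => (a j : A)) A (fun J => (c J : A)) J,
          koszulD_mem (fun j => (a j).2) (fun J => (c J).2) J⟩ := by
  have h : (⟨koszulD (fun j => (a j : A)) A (fun J => (c J : A)) J,
          koszulD_mem (fun j => (a j).2) (fun J => (c J).2) J⟩ : ↥(I ^ (n + 1)))
      = ∑ j ∈ J, koszulSign A j J • ⟨a j * c (J.erase j), by
          rw [pow_succ']; exact Ideal.mul_mem_mul (a j).2 (c _).2⟩ := by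
    ext1
    rw [AddSubmonoidClass.coe_finsetSum]
    simp only [koszulD_apply_apply, smul_eq_mul, SetLike.val_smul]
    exact Finset.sum_congr rfl fun j _ => by ring
  rw [h, map_sum, koszulD_apply_apply]
  refine Finset.sum_congr rfl fun j _ => ?_
  rw [map_smul, ← grDegreeOne_mul_toGr]
  have hs : (koszulSign A j J) • (grDegreeOne I (a j) * toGr I n (c (J.erase j)))
      = koszulSign (Gr I) j J • (grDegreeOne I (a j) * toGr I n (c (J.erase j))) := by
    rw [algebra_compatible_smul (Gr I), koszulSign, koszulSign, map_pow, map_neg, map_one]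
  rw [hs]
  exact mul_left_comm (grDegreeOne I (a j)) (koszulSign (Gr I) j J) (toGr I n _)

/-- Exactness of the Koszul complex of `a` on `gr_I(A)` at the cochains with values of degree
`ℓ + 1`, expressed by elements of `A`. -/
def GrExact (I : Ideal A) (a : Fin r → A) (ℓ : ℕ) : Prop :=
  ∀ c : Finset (Fin r) → A, (∀ J, c J ∈ I ^ (ℓ + 1)) → (∀ J, koszulD a A c J ∈ I ^ (ℓ + 3)) →
    ∃ b : Finset (Fin r) → A, (∀ J, b J ∈ I ^ ℓ) ∧ ∀ J, c J - koszulD a A b J ∈ I ^ (ℓ + 2)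

theorem koszulExact_grComponent_iff (a : Fin r → I) (ℓ : ℕ) :
    KoszulExact (fun n => (grComponent I n).toAddSubgroup) (fun j => grDegreeOne I (a j))
      ((ℓ + 1 : ℕ) : ℤ) ↔ GrExact I (fun j => (a j : A)) ℓ := by
  have hℓ : (((ℓ + 1 : ℕ) : ℤ) - 1) = (ℓ : ℕ) := by push_cast; ring
  rw [KoszulExact, hℓ]
  constructor
  · intro h c hc hdc
    obtain ⟨b, hb, hdb⟩ := h (fun J => toGr I (ℓ + 1) ⟨c J, hc J⟩) (fun J => toGr_mem I _ _) (by
      funext J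
      rw [koszulD_toGr a (ℓ + 1) (fun J => ⟨c J, hc J⟩), Pi.zero_apply, toGr_eq_zero_iff]
      exact hdc J)
    choose b' hb' using fun J => exists_toGr_eq I (hb J)
    refine ⟨fun J => b' J, fun J => (b' J).2, fun J => ?_⟩
    have h1 := congrFun hdb J
    have h2 : b = fun J => toGr I ℓ (b' J) := funext fun J => (hb' J).symm
    rw [h2, koszulD_toGr, eq_comm, ← sub_eq_zero, ← map_sub, toGr_eq_zero_iff] at h1
    exact h1
  · intro h c hc hdc
    choose c' hc' using fun J => exists_toGr_eq I (hc J)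
    have h2 : c = fun J => toGr I (ℓ + 1) (c' J) := funext fun J => (hc' J).symm
    obtain ⟨b, hb, hdb⟩ := h (fun J => c' J) (fun J => (c' J).2) (fun J => by
      have h1 := congrFun hdc J
      rw [h2, koszulD_toGr, Pi.zero_apply, toGr_eq_zero_iff] at h1
      exact h1)
    refine ⟨fun J => toGr I ℓ ⟨b J, hb J⟩, fun J => toGr_mem I _ _, funext fun J => ?_⟩
    rw [koszulD_toGr a ℓ (fun J => ⟨b J, hb J⟩), h2, eq_comm, ← sub_eq_zero, ← map_sub,
      toGr_eq_zero_iff]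
    exact hdb J

end GradedRing

section Noetherian

variable {A : Type*} [CommRing A] {I : Ideal A} {r : ℕ} {a : Fin r → A}

theorem mem_pow_smul_top {ι : Type*} [Fintype ι] {n : ℕ} {c : ι → A} (hc : ∀ i, c i ∈ I ^ n) :
    c ∈ I ^ n • (⊤ : Submodule A (ι → A)) := by
  classical
  rw [show c = ∑ i, c i • Pi.single (M := fun _ => A) i (1 : A) from by
    funext j; simp [Finset.sum_apply, Pi.single_apply]]
  exact sum_mem fun i _ => Submodule.smul_mem_smul (hc i) trivial

/-- A multiple by an element of `I` of a Koszul cochain is a coboundary up to contractions of the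
differential of the cochain. -/
theorem exists_koszulD_of_mem_smul (ha : I = Ideal.span (Set.range a)) {n : ℕ} {T : Ideal A}
    {Z : Submodule A (Finset (Fin r) → A)}
    (hZ : ∀ z ∈ Z, (∀ J, z J ∈ I ^ n) ∧ ∀ J, koszulD a A z J ∈ T)
    {c : Finset (Fin r) → A} (hc : c ∈ I • Z) :
    ∃ b : Finset (Fin r) → A, (∀ J, b J ∈ I ^ n) ∧ ∀ J, c J - koszulD a A b J ∈ T := by
  have hcontr : ∀ (m : Ideal A) (z : Finset (Fin r) → A), (∀ J, z J ∈ m) →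
      ∀ (t : Fin r → A) J, (∑ i, t i • contract (R := A) i z) J ∈ m := fun m z hz t J => by
    rw [Finset.sum_apply]
    refine sum_mem fun i _ => Ideal.mul_mem_left _ _ ?_
    rw [contract_apply]
    split_ifs
    · exact zero_mem _
    · exact Ideal.mul_mem_left _ _ (hz _)
  induction hc using Submodule.smul_induction_on' with
  | smul i hi z hz =>
    obtain ⟨hz1, hz2⟩ := hZ z hz
    rw [ha, Ideal.mem_span_range_iff_exists_fun] at hi
    obtain ⟨t, rfl⟩ := hi
    refine ⟨_, hcontr _ z hz1 t, fun J => ?_⟩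
    rw [← koszulD_contract_add a t z, Pi.add_apply, add_sub_cancel_left]
    exact hcontr _ _ hz2 t J
  | add c _ c' _ hc hc' =>
    obtain ⟨b, hb, hdb⟩ := hc
    obtain ⟨b', hb', hdb'⟩ := hc'
    refine ⟨b + b', fun J => add_mem (hb J) (hb' J), fun J => ?_⟩
    rw [map_add, Pi.add_apply, Pi.add_apply, add_sub_add_comm]
    exact add_mem (hdb J) (hdb' J)

/-- The Koszul homology of `gr_I(A)` vanishes in high degrees, since it is finitely generated and
killed by `gr_I(A)_1`. The finite generation is the stability of the filtration of
`A ⊗ Λ(A^r)` by the cochains whose classes are cocycles. -/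
theorem grExact_of_ge [IsNoetherianRing A] (ha : I = Ideal.span (Set.range a)) :
    ∃ n₀, ∀ ℓ ≥ n₀, GrExact I a ℓ := by
  let F : I.Filtration (Finset (Fin r) → A) :=
    { N := fun n =>
        { carrier := {c | (∀ J, c J ∈ I ^ n) ∧ ∀ J, koszulD a A c J ∈ I ^ (n + 2)}
          zero_mem' := ⟨fun _ => zero_mem _, fun _ => by rw [map_zero]; exact zero_mem _⟩
          add_mem' := fun hb hc => ⟨fun J => add_mem (hb.1 J) (hc.1 J), fun J => by
            rw [map_add]; exact add_mem (hb.2 J) (hc.2 J)⟩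
          smul_mem' := fun t c hc => ⟨fun J => Ideal.mul_mem_left _ _ (hc.1 J), fun J => by
            rw [map_smul]; exact Ideal.mul_mem_left _ _ (hc.2 J)⟩ }
      mono := fun n c hc => ⟨fun J => Ideal.pow_le_pow_right n.le_succ (hc.1 J),
        fun J => Ideal.pow_le_pow_right (by omega) (hc.2 J)⟩
      smul_le := fun n => by
        rw [Submodule.smul_le]
        intro t ht c hc
        refine ⟨fun J => ?_, fun J => ?_⟩
        · rw [pow_succ']; exact Ideal.mul_mem_mul ht (hc.1 J)
        · rw [map_smul, add_right_comm, pow_succ']; exact Ideal.mul_mem_mul ht (hc.2 J) }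
  have hF : F ≤ I.stableFiltration ⊤ := fun n c hc => mem_pow_smul_top hc.1
  obtain ⟨n₀, hn₀⟩ := (I.stableFiltration_stable ⊤).of_le hF
  refine ⟨n₀, fun ℓ hℓ c hc hdc => ?_⟩
  have hcF : c ∈ I • F.N ℓ := by
    rw [hn₀ ℓ hℓ]
    exact ⟨hc, hdc⟩
  exact exists_koszulD_of_mem_smul ha (fun z hz => hz) hcF

/-- Exactness of the Koszul complex of `a` on `gr_I(A)` above a degree lifts to the Koszul complex
of `A` with its `I`-adic filtration: a cocycle is corrected degree by degree, which ends because
exactness holds in high degrees. -/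
theorem koszulExact_pow_of_grExact [IsNoetherianRing A] (ha : I = Ideal.span (Set.range a))
    {m : ℕ} (h : ∀ ℓ ≥ m, GrExact I a ℓ) {ℓ : ℕ} (hℓ : m ≤ ℓ) {c : Finset (Fin r) → A}
    (hc : ∀ J, c J ∈ I ^ (ℓ + 1)) (hdc : koszulD a A c = 0) :
    ∃ b : Finset (Fin r) → A, (∀ J, b J ∈ I ^ ℓ) ∧ koszulD a A b = c := by
  -- the filtration of the cocycles, stable by the Artin–Rees lemma
  let F : I.Filtration (Finset (Fin r) → A) :=
    { N := fun n =>
        { carrier := {c | (∀ J, c J ∈ I ^ n) ∧ koszulD a A c = 0}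
          zero_mem' := ⟨fun _ => zero_mem _, map_zero _⟩
          add_mem' := fun hb hc => ⟨fun J => add_mem (hb.1 J) (hc.1 J), by
            rw [map_add, hb.2, hc.2, add_zero]⟩
          smul_mem' := fun t c hc => ⟨fun J => Ideal.mul_mem_left _ _ (hc.1 J), by
            rw [map_smul, hc.2, smul_zero]⟩ }
      mono := fun n c hc => ⟨fun J => Ideal.pow_le_pow_right n.le_succ (hc.1 J), hc.2⟩
      smul_le := fun n => by
        rw [Submodule.smul_le]
        intro t ht c hc
        refine ⟨fun J => ?_, ?_⟩
        · rw [pow_succ']; exact Ideal.mul_mem_mul ht (hc.1 J)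
        · rw [map_smul, hc.2, smul_zero] }
  have hF : F ≤ I.stableFiltration ⊤ := fun n c hc => mem_pow_smul_top hc.1
  obtain ⟨n₀, hn₀⟩ := (I.stableFiltration_stable ⊤).of_le hF
  -- exactness in high degrees, where the contractions of a cocycle are a homotopy
  have high : ∀ ℓ ≥ n₀, ∀ c : Finset (Fin r) → A, (∀ J, c J ∈ I ^ (ℓ + 1)) →
      koszulD a A c = 0 → ∃ b : Finset (Fin r) → A, (∀ J, b J ∈ I ^ ℓ) ∧ koszulD a A b = c := by
    intro ℓ hℓ c hc hdc
    have hcF : c ∈ I • F.N ℓ := by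
      rw [hn₀ ℓ hℓ]
      exact ⟨hc, hdc⟩
    obtain ⟨b, hb, hdb⟩ := exists_koszulD_of_mem_smul (T := ⊥) ha (Z := F.N ℓ)
      (fun z hz => ⟨hz.1, fun J => by rw [hz.2]; rfl⟩) hcF
    exact ⟨b, hb, funext fun J => (sub_eq_zero.mp (hdb J)).symm⟩
  suffices H : ∀ k ℓ : ℕ, m ≤ ℓ → n₀ ≤ ℓ + k → ∀ c : Finset (Fin r) → A,
      (∀ J, c J ∈ I ^ (ℓ + 1)) → koszulD a A c = 0 →
      ∃ b : Finset (Fin r) → A, (∀ J, b J ∈ I ^ ℓ) ∧ koszulD a A b = c from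
    H n₀ ℓ hℓ (by omega) c hc hdc
  intro k
  induction k with
  | zero => exact fun ℓ _ hℓ => high ℓ hℓ
  | succ k ih =>
    intro ℓ hℓ hk c hc hdc
    obtain ⟨b, hb, hdb⟩ := h ℓ hℓ c hc (fun J => by rw [hdc]; exact zero_mem _)
    obtain ⟨b', hb', hdb'⟩ := ih (ℓ + 1) (by omega) (by omega) (c - koszulD a A b) hdb
      (by rw [map_sub, hdc, koszulD_koszulD, sub_zero])
    refine ⟨b + b', fun J => add_mem (hb J) (Ideal.pow_le_pow_right ℓ.le_succ (hb' J)), ?_⟩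
    rw [map_add, hdb', add_sub_cancel]

end Noetherian

/-! ### Regularity of the associated graded ring -/

section RegGr

variable {A : Type*} [CommRing A]

theorem span_range_gens [IsNoetherianRing A] (I : Ideal A) :
    Ideal.span (Set.range fun i => (gens I i : A)) = I :=
  (exists_generators I).choose_spec.choose_spec

theorem regGr_le_of_grExact [IsNoetherianRing A] {I : Ideal A} {N : ℕ}
    (h : ∀ ℓ ≥ N, GrExact I (fun i => (gens I i : A)) ℓ) :
    regGr I ≤ (((N : ℤ) : WithTop ℤ) : WithBot (WithTop ℤ)) := by
  rw [regGr, regularity_le_iff]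
  refine cechExact_of_koszulExact (fun j n z hz => grDegreeOne_mul_mem (gens I j) n hz) ?_
  intro ℓ hℓ
  obtain ⟨k, rfl⟩ : ∃ k : ℕ, ℓ = ((k + 1 : ℕ) : ℤ) := ⟨(ℓ - 1).toNat, by omega⟩
  exact (koszulExact_grComponent_iff _ _).mpr (h k (by omega))

/-- Over a proper ideal the Koszul complex of `gr_I(A)` is not exact in level `0`: the unit of
`gr_I(A)_0 = A / I`, placed in the top exterior power, is a cocycle. -/
theorem not_koszulExact_zero {I : Ideal A} (hI : I ≠ ⊤) {r : ℕ} (x : Fin r → Gr I) :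
    ¬ KoszulExact (fun n => (grComponent I n).toAddSubgroup) x 0 := by
  intro h
  have h1 : toGr I 0 ⟨1, by simp⟩ ≠ 0 := fun h1 => by
    rw [toGr_eq_zero_iff, zero_add, pow_one] at h1
    exact hI ((Ideal.eq_top_iff_one I).mpr h1)
  obtain ⟨b, hb, hdb⟩ := h (fun J => if J = Finset.univ then toGr I 0 ⟨1, by simp⟩ else 0)
    (fun J => by
      beta_reduce
      split_ifs
      · exact toGr_mem I 0 _
      · exact zero_mem _) (koszulD_eq_zero_of_top x fun J hJ => if_neg hJ)
  have hb0 : b = 0 := funext fun J => by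
    have := hb J
    change b J ∈ grComponent I (0 - 1) at this
    rw [grComponent_eq_bot_of_neg I (by omega)] at this
    exact this
  have := congrFun hdb Finset.univ
  rw [hb0, map_zero, if_pos rfl] at this
  exact h1 this.symm

/-- The regularity of `gr_I(A)` is a natural number `m`, and above the degree `m` the Koszul complex
of `gr_I(A)` is exact for any generators of `I`. -/
theorem exists_regGr_eq [IsNoetherianRing A] {I : Ideal A} (hI : I ≠ ⊤) :
    ∃ m : ℕ, regGr I = (((m : ℤ) : WithTop ℤ) : WithBot (WithTop ℤ)) ∧
      ∀ {s : ℕ} (b : Fin s → I), Ideal.span (Set.range fun i => (b i : A)) = I →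
        ∀ ℓ ≥ m, GrExact I (fun i => (b i : A)) ℓ := by
  have hK : ∀ {s : ℕ} (b : Fin s → I), Ideal.span (Set.range fun i => (b i : A)) = I → ∀ ℓ,
      CechExact (fun n => (grComponent I n).toAddSubgroup) (fun i => grDegreeOne I (gens I i)) ℓ →
      KoszulExact (fun n => (grComponent I n).toAddSubgroup) (fun i => grDegreeOne I (b i)) ℓ := by
    intro s b hb ℓ hC
    have hex : ∀ j, ∃ t : Fin s → A, ∑ i, t i * (b i : A) = gens I j := fun j =>
      Ideal.mem_span_range_iff_exists_fun.mp (by rw [hb]; exact (gens I j).2)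
    choose t ht using hex
    refine koszulExact_of_cechExact (a := fun j i => algebraMap A (Gr I) (t j i))
      (fun j n z hz => grDegreeOne_mul_mem (gens I j) n hz)
      (fun j n z hz => grDegreeOne_mul_mem (b j) n hz) (fun j i n z hz => ?_) (fun j => ?_) hC
    · rw [algebraMap_smul]
      exact (grComponent I n).smul_mem _ hz
    · rw [grDegreeOne_eq]
      have : (⟨(gens I j : A), by rw [pow_one]; exact (gens I j).2⟩ : ↥(I ^ 1))
          = ∑ i, t j i • ⟨(b i : A), by rw [pow_one]; exact (b i).2⟩ := by
        ext1
        rw [AddSubmonoidClass.coe_finsetSum]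
        exact (ht j).symm
      rw [this, map_sum]
      refine Finset.sum_congr rfl fun i _ => ?_
      rw [map_smul, grDegreeOne_eq]
      exact Algebra.smul_def (t j i) (toGr I 1 _)
  obtain ⟨n₀, hn₀⟩ := grExact_of_ge (a := fun i => (gens I i : A)) (span_range_gens I).symm
  have hle := regGr_le_of_grExact hn₀
  rw [regGr, regularity_le_iff] at hle
  obtain ⟨m, hm⟩ := exists_regularity_eq hle
    ⟨0, le_rfl, fun h => not_koszulExact_zero hI _ (hK _ (span_range_gens I) 0 h)⟩
  refine ⟨m, hm, fun {s} b hb ℓ hℓ => ?_⟩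
  rw [← koszulExact_grComponent_iff]
  exact hK b hb _ ((regularity_le_iff _).mp hm.le _ (by omega))

end RegGr

/-! ### The quotient by `x` and the ideals `I^{n+1} : x` -/

section Superficial

variable {A : Type*} [CommRing A] {I : Ideal A} {x : A} {r : ℕ} {g : Fin r → A}

theorem mk_mem_map_pow_iff (I : Ideal A) (x a : A) (n : ℕ) :
    Ideal.Quotient.mk (Ideal.span {x}) a ∈ I.map (Ideal.Quotient.mk (Ideal.span {x})) ^ n ↔
      a ∈ I ^ n ⊔ Ideal.span {x} := by
  rw [← Ideal.map_pow, Ideal.mem_quotient_iff_mem_sup]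

theorem koszulD_mk (J : Ideal A) (g : Fin r → A) (c : Finset (Fin r) → A) :
    koszulD (fun i => Ideal.Quotient.mk J (g i)) (A ⧸ J) (fun K => Ideal.Quotient.mk J (c K))
      = fun K => Ideal.Quotient.mk J (koszulD g A c K) := by
  funext K
  simp only [koszulD_apply_apply, map_sum, smul_eq_mul, map_mul, koszulSign, map_pow, map_neg,
    map_one]

/-- `GrExact` for the image of `I` in `A / xA`, expressed by elements of `A`. -/
theorem exists_of_grExact_quotient {ℓ : ℕ}
    (h : GrExact (I.map (Ideal.Quotient.mk (Ideal.span {x})))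
      (fun i => Ideal.Quotient.mk (Ideal.span {x}) (g i)) ℓ)
    {c : Finset (Fin r) → A} (hc : ∀ J, c J ∈ I ^ (ℓ + 1))
    (hdc : ∀ J, koszulD g A c J ∈ I ^ (ℓ + 3) ⊔ Ideal.span {x}) :
    ∃ b : Finset (Fin r) → A, (∀ J, b J ∈ I ^ ℓ) ∧
      ∀ J, ∃ f ∈ I ^ (ℓ + 2), ∃ e, c J - koszulD g A b J = f + x * e := by
  obtain ⟨b', hb', hdb'⟩ := h (fun J => Ideal.Quotient.mk _ (c J))
    (fun J => (mk_mem_map_pow_iff I x _ _).mpr (Ideal.mem_sup_left (hc J)))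
    (fun J => by rw [koszulD_mk]; exact (mk_mem_map_pow_iff I x _ _).mpr (hdc J))
  have hlift : ∀ J, ∃ b ∈ I ^ ℓ, Ideal.Quotient.mk (Ideal.span {x}) b = b' J := fun J => by
    have := hb' J
    rwa [← Ideal.map_pow, Ideal.mem_map_iff_of_surjective _ Ideal.Quotient.mk_surjective] at this
  choose b hb hbb' using hlift
  refine ⟨b, hb, fun J => ?_⟩
  have h1 := hdb' J
  rw [← funext hbb', koszulD_mk, ← map_sub, mk_mem_map_pow_iff, Submodule.mem_sup] at h1
  obtain ⟨f, hf, e, he, hfe⟩ := h1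
  obtain ⟨e, rfl⟩ := Ideal.mem_span_singleton.mp he
  exact ⟨f, hf, e, hfe.symm⟩

/-- The ideal `I^{n+1} : x`. -/
def colonPow (I : Ideal A) (x : A) (n : ℕ) : Ideal A :=
  Submodule.comap (LinearMap.mulLeft A x) (I ^ (n + 1))

theorem mem_colonPow {n : ℕ} {a : A} : a ∈ colonPow I x n ↔ x * a ∈ I ^ (n + 1) := Iff.rfl

theorem pow_le_colonPow (hx : x ∈ I) (n : ℕ) : I ^ n ≤ colonPow I x n := fun a ha => by
  rw [mem_colonPow, pow_succ']
  exact Ideal.mul_mem_mul hx ha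

theorem colonPow_antitone : Antitone (colonPow I x) := fun _ _ h _ ha =>
  Ideal.pow_le_pow_right (Nat.succ_le_succ h) ha

theorem exists_sum_of_mem_mul (hg : I = Ideal.span (Set.range g)) {K : Ideal A} {z : A}
    (hz : z ∈ I * K) : ∃ b : Fin r → A, (∀ i, b i ∈ K) ∧ z = ∑ i, g i * b i := by
  induction hz using Submodule.mul_induction_on' with
  | mem_mul_mem u hu v hv =>
    rw [hg, Ideal.mem_span_range_iff_exists_fun] at hu
    obtain ⟨t, rfl⟩ := hu
    refine ⟨fun i => t i * v, fun i => Ideal.mul_mem_left _ _ hv, ?_⟩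
    rw [Finset.sum_mul]
    exact Finset.sum_congr rfl fun i _ => by ring
  | add u _ v _ hu hv =>
    obtain ⟨b, hb, rfl⟩ := hu
    obtain ⟨b', hb', rfl⟩ := hv
    refine ⟨b + b', fun i => add_mem (hb i) (hb' i), ?_⟩
    rw [← Finset.sum_add_distrib]
    exact Finset.sum_congr rfl fun i _ => by rw [Pi.add_apply, mul_add]

/-- The kernel `⨁ (xA ∩ I^n + I^{n+1}) / I^{n+1}` of `gr_I(A) → gr_{I/xA}(A/xA)` has no new
generators in the degrees above `m + 1`, because the first Koszul homology of the target vanishes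
there. -/
theorem colonPow_succ_le_sup (hg : I = Ideal.span (Set.range g)) {n : ℕ}
    (h : GrExact (I.map (Ideal.Quotient.mk (Ideal.span {x})))
      (fun i => Ideal.Quotient.mk (Ideal.span {x}) (g i)) n) :
    colonPow I x (n + 1) ≤ I * colonPow I x n ⊔ colonPow I x (n + 2) := by
  have hgI : ∀ i, g i ∈ I := fun i => hg ▸ Ideal.subset_span ⟨i, rfl⟩
  intro a ha
  rw [mem_colonPow, pow_succ'] at ha
  obtain ⟨b, hb, hab⟩ := exists_sum_of_mem_mul hg ha
  -- `E z` is `z` in the top exterior power; the relation `x a = ∑ g_i b_i` makes the contraction `c`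
  -- of `(b_i)` a cocycle over `A / xA`, which is a coboundary modulo higher degree
  let E : A → Finset (Fin r) → A := fun z J => if J = Finset.univ then z else 0
  have hE : ∀ z, koszulD g A (E z) = 0 := fun z => koszulD_eq_zero_of_top g fun J hJ => if_neg hJ
  let c : Finset (Fin r) → A := ∑ i, contract (R := A) i (E (b i))
  have hdc : koszulD g A c = E (x * a) := by
    have h1 : ∀ i, koszulD g A (contract (R := A) i (E (b i))) = g i • E (b i) := fun i => by
      have := koszulD_contract_add g (Pi.single i 1) (E (b i))
      simpa [hE, Pi.single_apply] using this
    funext J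
    rw [map_sum, Finset.sum_apply, hab]
    simp only [h1, Pi.smul_apply, smul_eq_mul, E]
    split_ifs <;> simp
  have hc : ∀ J, c J ∈ I ^ (n + 1) := fun J => by
    change (∑ i, contract (R := A) i (E (b i))) J ∈ _
    rw [Finset.sum_apply]
    refine sum_mem fun i _ => ?_
    rw [contract_apply]
    split_ifs
    · exact zero_mem _
    · refine Ideal.mul_mem_left _ _ ?_
      simp only [E]
      split_ifs
      · exact hb i
      · exact zero_mem _
  obtain ⟨b', hb', hcb⟩ := exists_of_grExact_quotient h hc (fun J => by
    rw [hdc]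
    simp only [E]
    split_ifs
    · exact Ideal.mem_sup_right (Ideal.mul_mem_right _ _ (Ideal.mem_span_singleton_self x))
    · exact zero_mem _)
  choose f hf e hfe using hcb
  have he : ∀ J, e J ∈ colonPow I x n := fun J => by
    rw [mem_colonPow, show x * e J = c J - koszulD g A b' J - f J by rw [hfe]; ring]
    exact sub_mem (sub_mem (hc J) (koszulD_mem hgI hb' J))
      (Ideal.pow_le_pow_right (by omega) (hf J))
  have hsum : x * a = koszulD g A f Finset.univ + x * koszulD g A e Finset.univ := by
    have h1 : c - koszulD g A b' = f + x • e := funext hfe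
    have h2 := congrFun (congrArg (koszulD g A) h1) Finset.univ
    rw [map_sub, koszulD_koszulD, hdc, sub_zero, map_add, map_smul, Pi.add_apply, Pi.smul_apply,
      smul_eq_mul] at h2
    rw [← h2]
    exact (if_pos rfl).symm
  rw [← add_sub_cancel (koszulD g A e Finset.univ) a]
  refine Submodule.add_mem_sup ?_ ?_
  · rw [koszulD_apply_apply]
    exact sum_mem fun i _ => Ideal.mul_mem_mul (hgI i) (Ideal.mul_mem_left _ _ (he _))
  · rw [mem_colonPow, mul_sub, hsum, add_sub_cancel_right]
    exact koszulD_mem hgI hf _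

/-- For `n ≥ m` the ideal `I^{n+2} : x` is generated by `I^{n+1} : x`: the error terms of
`colonPow_succ_le_sup` have arbitrarily high degree, where `I^{k+1} : x ⊆ I^k`. -/
theorem colonPow_succ_le_mul (hxI : x ∈ I) (hg : I = Ideal.span (Set.range g)) {m k₀ : ℕ}
    (h : ∀ ℓ ≥ m, GrExact (I.map (Ideal.Quotient.mk (Ideal.span {x})))
      (fun i => Ideal.Quotient.mk (Ideal.span {x}) (g i)) ℓ)
    (hk₀ : ∀ k ≥ k₀, colonPow I x k ≤ I ^ k) {n : ℕ} (hn : m ≤ n) :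
    colonPow I x (n + 1) ≤ I * colonPow I x n := by
  have key : ∀ k, colonPow I x (n + 1) ≤ I * colonPow I x n ⊔ colonPow I x (n + 1 + k) := by
    intro k
    induction k with
    | zero => exact le_sup_right
    | succ k ih =>
      refine ih.trans (sup_le le_sup_left ?_)
      have := colonPow_succ_le_sup hg (h (n + k) (by omega))
      rw [add_right_comm n 1 k]
      refine this.trans (sup_le_sup (Ideal.mul_mono_right (colonPow_antitone (by omega))) ?_)
      exact colonPow_antitone (by omega)
  refine (key k₀).trans (sup_le le_rfl ((hk₀ _ (by omega)).trans ?_))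
  refine (Ideal.pow_le_pow_right (show n + 1 ≤ n + 1 + k₀ by omega)).trans ?_
  rw [pow_succ']
  exact Ideal.mul_mono_right (pow_le_colonPow hxI n)

/-- If `I^{n+1} : x = I^n` for all `n ≥ N`, exactness of the Koszul complex of
`gr_{I/xA}(A/xA)` in the degrees above `N` lifts to `gr_I(A)`: there multiplication by `x` is
injective with cokernel `gr_{I/xA}(A/xA)`, and it is null-homotopic on the Koszul complex. -/
theorem grExact_of_quotient (hxI : x ∈ I) (hg : I = Ideal.span (Set.range g)) {N : ℕ}
    (h : ∀ ℓ ≥ N, GrExact (I.map (Ideal.Quotient.mk (Ideal.span {x})))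
      (fun i => Ideal.Quotient.mk (Ideal.span {x}) (g i)) ℓ)
    (hN : ∀ k ≥ N, colonPow I x k ≤ I ^ k) {ℓ : ℕ} (hℓ : N ≤ ℓ) : GrExact I g ℓ := by
  have hgI : ∀ i, g i ∈ I := fun i => hg ▸ Ideal.subset_span ⟨i, rfl⟩
  intro c hc hdc
  obtain ⟨b, hb, hcb⟩ := exists_of_grExact_quotient (h ℓ hℓ) hc
    (fun J => Ideal.mem_sup_left (hdc J))
  choose f hf y hfy using hcb
  have h1 : c - koszulD g A b = f + x • y := funext hfy
  have hy : ∀ J, y J ∈ I ^ ℓ := fun J => hN ℓ hℓ (by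
    rw [mem_colonPow, show x * y J = c J - koszulD g A b J - f J by rw [hfy]; ring]
    exact sub_mem (sub_mem (hc J) (koszulD_mem hgI hb J))
      (Ideal.pow_le_pow_right (by omega) (hf J)))
  have hdy : ∀ J, koszulD g A y J ∈ I ^ (ℓ + 2) := fun J => hN (ℓ + 2) (by omega) (by
    have h2 := congrFun (congrArg (koszulD g A) h1) J
    rw [map_sub, koszulD_koszulD, sub_zero, map_add, map_smul, Pi.add_apply, Pi.smul_apply,
      smul_eq_mul] at h2
    rw [mem_colonPow, show x * koszulD g A y J = koszulD g A c J - koszulD g A f J by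
      rw [h2]; ring]
    exact sub_mem (hdc J) (koszulD_mem hgI hf J))
  have hx := hxI
  rw [hg, Ideal.mem_span_range_iff_exists_fun] at hx
  obtain ⟨t, ht⟩ := hx
  have hcontr : ∀ (T : Ideal A) (z : Finset (Fin r) → A), (∀ J, z J ∈ T) →
      ∀ J, (∑ i, t i • contract (R := A) i z) J ∈ T := fun T z hz J => by
    rw [Finset.sum_apply]
    refine sum_mem fun i _ => Ideal.mul_mem_left _ _ ?_
    rw [contract_apply]
    split_ifs
    · exact zero_mem _
    · exact Ideal.mul_mem_left _ _ (hz _)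
  have h3 := koszulD_contract_add g t y
  rw [ht] at h3
  refine ⟨b + ∑ i, t i • contract (R := A) i y, fun J => add_mem (hb J) (hcontr _ y hy J),
    fun J => ?_⟩
  have h4 : c - koszulD g A (b + ∑ i, t i • contract (R := A) i y)
      = f + ∑ i, t i • contract (R := A) i (koszulD g A y) := by
    rw [map_add, ← sub_sub, h1, ← h3]
    abel
  rw [← Pi.sub_apply, h4]
  exact add_mem (hf J) (hcontr _ _ hdy J)

/-- `H^0_I(A/xA)` meets the `(ℓ+1)`-st power of `I/xA` in `0` for `ℓ ≥ m`. -/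
theorem mem_span_of_torsion [IsNoetherianRing A] (hg : I = Ideal.span (Set.range g)) {m : ℕ}
    (h : ∀ ℓ ≥ m, GrExact (I.map (Ideal.Quotient.mk (Ideal.span {x})))
      (fun i => Ideal.Quotient.mk (Ideal.span {x}) (g i)) ℓ)
    {ℓ k : ℕ} (hℓ : m ≤ ℓ) {a : A} (ha : a ∈ I ^ (ℓ + 1))
    (hk : ∀ u ∈ I ^ k, u * a ∈ Ideal.span {x}) : a ∈ Ideal.span {x} := by
  have hgI : ∀ i, g i ∈ I := fun i => hg ▸ Ideal.subset_span ⟨i, rfl⟩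
  have hspan : I.map (Ideal.Quotient.mk (Ideal.span {x}))
      = Ideal.span (Set.range fun i => Ideal.Quotient.mk (Ideal.span {x}) (g i)) := by
    rw [hg, Ideal.map_span, ← Set.range_comp]; rfl
  induction k generalizing ℓ a with
  | zero => simpa using hk 1 (by simp)
  | succ k ih =>
    refine ih hℓ ha fun u hu => ?_
    have hua : u * a ∈ I ^ (ℓ + k + 1) := by
      rw [show ℓ + k + 1 = k + (ℓ + 1) by ring, pow_add]
      exact Ideal.mul_mem_mul hu ha
    let c : Finset (Fin r) → A ⧸ Ideal.span {x} := fun J =>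
      if J = ∅ then Ideal.Quotient.mk _ (u * a) else 0
    obtain ⟨b, -, hdb⟩ := koszulExact_pow_of_grExact hspan h (show m ≤ ℓ + k by omega) (c := c)
      (fun J => by
        simp only [c]
        split_ifs
        · rw [mk_mem_map_pow_iff]; exact Ideal.mem_sup_left hua
        · exact zero_mem _)
      (by
        funext J
        rw [koszulD_apply_apply]
        refine Finset.sum_eq_zero fun i _ => ?_
        simp only [c]
        split_ifs
        · rw [smul_comm, smul_eq_mul (a := Ideal.Quotient.mk _ (g i)), ← map_mul,
            Ideal.Quotient.eq_zero_iff_mem.mpr, smul_zero]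
          rw [← mul_assoc]
          exact hk _ (by rw [pow_succ']; exact Ideal.mul_mem_mul (hgI i) hu)
        · simp)
    have := congrFun hdb ∅
    rw [koszulD_apply_apply, Finset.sum_empty] at this
    exact Ideal.Quotient.eq_zero_iff_mem.mp (by simpa [c] using this.symm)

end Superficial

/-! ### Sections over `Proj` of the Rees algebra -/

section Saturation

variable {A : Type*} [CommRing A] (I : Ideal A) (B : Type*) [CommRing B] [Algebra A B]

/-- The image of `I^n` in the `A`-algebra `B`. -/
def powImage (n : ℕ) : Submodule A B := Submodule.map (Algebra.linearMap A B) (I ^ n)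

variable {I B}

theorem algebraMap_mem_powImage {n : ℕ} {a : A} (ha : a ∈ I ^ n) :
    algebraMap A B a ∈ powImage I B n := ⟨a, ha, rfl⟩

theorem powImage_antitone : Antitone (powImage I B) := fun _ _ h =>
  Submodule.map_mono (Ideal.pow_le_pow_right h)

theorem smul_mem_powImage {j n : ℕ} {u : A} (hu : u ∈ I ^ j) {z : B} (hz : z ∈ powImage I B n) :
    u • z ∈ powImage I B (j + n) := by
  obtain ⟨a, ha, rfl⟩ := hz
  refine ⟨u * a, by rw [pow_add]; exact Ideal.mul_mem_mul hu ha, ?_⟩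
  exact (Algebra.linearMap A B).map_smul u a

theorem smul_mem_powImage_of_le {n k k' : ℕ} (h : k ≤ k') {z : B}
    (hz : ∀ u ∈ I ^ k, u • z ∈ powImage I B (n + k)) :
    ∀ u ∈ I ^ k', u • z ∈ powImage I B (n + k') := by
  obtain ⟨j, rfl⟩ := Nat.exists_eq_add_of_le' h
  intro u hu
  rw [pow_add] at hu
  induction hu using Submodule.mul_induction_on' with
  | mem_mul_mem v hv w hw =>
    rw [mul_smul, show n + (j + k) = j + (n + k) by ring]
    exact smul_mem_powImage hv (hz w hw)
  | add v _ w _ hv hw => rw [add_smul]; exact add_mem hv hw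

variable (I B) in
/-- The submodule of the `z ∈ B` with `I^k z ⊆ I^{n+k}` for large `k`. For `B` a localization of `A`
at a nonzerodivisor `x ∈ I`, it is the module of the sections of degree `n` of the sheaf defined
on `Proj` by the Rees algebra of `I`, and its quotient by `I^n` is the degree `n` part of the first
local cohomology of the Rees algebra with respect to the ideal of the elements of positive
degree. -/
def satPow (n : ℕ) : Submodule A B where
  carrier := {z | ∃ k, ∀ u ∈ I ^ k, u • z ∈ powImage I B (n + k)}
  zero_mem' := ⟨0, fun u _ => by rw [smul_zero]; exact zero_mem _⟩
  add_mem' := by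
    rintro z w ⟨k, hk⟩ ⟨l, hl⟩
    refine ⟨max k l, fun u hu => ?_⟩
    rw [smul_add]
    exact add_mem (smul_mem_powImage_of_le (le_max_left k l) hk u hu)
      (smul_mem_powImage_of_le (le_max_right k l) hl u hu)
  smul_mem' := by
    rintro t z ⟨k, hk⟩
    refine ⟨k, fun u hu => ?_⟩
    rw [smul_comm]
    exact Submodule.smul_mem _ t (hk u hu)

theorem powImage_le_satPow (n : ℕ) : powImage I B n ≤ satPow I B n := fun z hz =>
  ⟨0, fun u hu => by simpa using Submodule.smul_mem _ u hz⟩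

theorem satPow_antitone : Antitone (satPow I B) := fun _ _ h _ ⟨k, hk⟩ =>
  ⟨k, fun u hu => powImage_antitone (by omega) (hk u hu)⟩

theorem smul_mem_satPow {n : ℕ} {t : A} (ht : t ∈ I) {z : B} (hz : z ∈ satPow I B n) :
    t • z ∈ satPow I B (n + 1) := by
  obtain ⟨k, hk⟩ := hz
  refine ⟨k, fun u hu => ?_⟩
  rw [smul_comm, show n + 1 + k = 1 + (n + k) by ring]
  exact smul_mem_powImage (by rwa [pow_one]) (hk u hu)

variable {x : A}

theorem algebraMap_mem_satPow_of_mem_colonPow {k₀ : ℕ}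
    (hk₀ : ∀ k ≥ k₀, colonPow I x k ≤ I ^ k) {n : ℕ} {a : A} (ha : a ∈ colonPow I x n) :
    algebraMap A B a ∈ satPow I B n := by
  refine ⟨k₀, fun u hu => ?_⟩
  rw [Algebra.smul_def, ← map_mul]
  refine algebraMap_mem_powImage (hk₀ _ (by omega) ?_)
  rw [mem_colonPow, mul_left_comm, show n + k₀ + 1 = k₀ + (n + 1) by ring, pow_add]
  exact Ideal.mul_mem_mul hu ha

/-- If `x z` is a section of degree `n + 1`, then `z` is one of degree `n`, provided that `I^k z ⊆ A`
for some `k`. -/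
theorem mem_satPow_of_smul_mem (hinj : Function.Injective (algebraMap A B))
    {k₀ : ℕ} (hk₀ : ∀ k ≥ k₀, colonPow I x k ≤ I ^ k) {n : ℕ} {z : B}
    {k : ℕ} (hk : ∀ u ∈ I ^ k, u • z ∈ powImage I B 0) (hxz : x • z ∈ satPow I B (n + 1)) :
    z ∈ satPow I B n := by
  obtain ⟨l, hl⟩ := hxz
  refine ⟨k + l + k₀, fun u hu => ?_⟩
  obtain ⟨a, -, ha⟩ := hk u (Ideal.pow_le_pow_right (by omega) hu)
  have h1 := smul_mem_powImage_of_le (show l ≤ k + l + k₀ by omega) hl u hu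
  obtain ⟨b, hb, hab⟩ := h1
  have hab' : algebraMap A B b = u • x • z := hab
  rw [smul_comm, ← ha, Algebra.linearMap_apply, Algebra.smul_def, ← map_mul] at hab'
  have := hinj hab'
  rw [← ha]
  refine algebraMap_mem_powImage (hk₀ _ (by omega) ?_)
  rw [mem_colonPow, ← this, add_right_comm]
  exact hb

section Exact

variable [IsNoetherianRing A] {r : ℕ} {g : Fin r → A} {m k₀ : ℕ}

/-- A section of degree `n ≥ m` whose multiple by `x` lies in `I^{n+1}` comes from `A`. -/
theorem exists_algebraMap_eq_of_smul_mem (hinj : Function.Injective (algebraMap A B))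
    (hxu : IsUnit (algebraMap A B x)) (hg : I = Ideal.span (Set.range g))
    (h : ∀ ℓ ≥ m, GrExact (I.map (Ideal.Quotient.mk (Ideal.span {x})))
      (fun i => Ideal.Quotient.mk (Ideal.span {x}) (g i)) ℓ)
    {n : ℕ} (hn : m ≤ n) {z : B} (hz : z ∈ satPow I B 0) (hxz : x • z ∈ powImage I B (n + 1)) :
    ∃ a ∈ colonPow I x n, algebraMap A B a = z := by
  obtain ⟨a, ha, hax⟩ := hxz
  have hax' : algebraMap A B a = algebraMap A B x * z := by rw [← Algebra.smul_def]; exact hax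
  obtain ⟨k, hk⟩ := hz
  have hmem : a ∈ Ideal.span {x} := by
    refine mem_span_of_torsion hg h hn ha (k := k) fun u hu => ?_
    obtain ⟨b, -, hb⟩ := hk u hu
    have hb' : algebraMap A B b = algebraMap A B u * z := by rw [← Algebra.smul_def]; exact hb
    rw [Ideal.mem_span_singleton]
    refine ⟨b, hinj ?_⟩
    rw [map_mul, map_mul, hax', hb']
    ring
  obtain ⟨b, rfl⟩ := Ideal.mem_span_singleton.mp hmem
  refine ⟨b, ha, ?_⟩
  rw [map_mul] at hax'
  exact hxu.mul_left_cancel hax'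

/-- For `n` large all sections of degree `n` lie in `I^n`, by induction on the power of `x` that
multiplies a section into `A`. -/
theorem satPow_le_powImage_of_ge (hxI : x ∈ I) (hinj : Function.Injective (algebraMap A B))
    (hxu : IsUnit (algebraMap A B x)) (hg : I = Ideal.span (Set.range g))
    (h : ∀ ℓ ≥ m, GrExact (I.map (Ideal.Quotient.mk (Ideal.span {x})))
      (fun i => Ideal.Quotient.mk (Ideal.span {x}) (g i)) ℓ)
    (hk₀ : ∀ k ≥ k₀, colonPow I x k ≤ I ^ k) {n : ℕ} (hn : m ≤ n) (hn' : k₀ ≤ n) :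
    satPow I B n ≤ powImage I B n := by
  have base : ∀ (j n : ℕ) (a : A), k₀ ≤ n → x ^ j * a ∈ I ^ (n + j) → a ∈ I ^ n := by
    intro j
    induction j with
    | zero => intro n a _ ha; simpa using ha
    | succ j ih =>
      intro n a hn ha
      refine hk₀ n hn (ih (n + 1) (x * a) (by omega) ?_)
      rw [← mul_assoc, ← pow_succ, add_right_comm]
      exact ha
  have key : ∀ (j n : ℕ) (z : B), m ≤ n → k₀ ≤ n → z ∈ satPow I B n →
      x ^ j • z ∈ powImage I B 0 → z ∈ powImage I B n := by
    intro j
    induction j with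
    | zero =>
      rintro n z - hn ⟨k, hk⟩ hz
      rw [pow_zero, one_smul] at hz
      obtain ⟨a, -, rfl⟩ := hz
      obtain ⟨b, hb, hab⟩ := hk (x ^ k) (Ideal.pow_mem_pow hxI k)
      have hab' : algebraMap A B b = algebraMap A B (x ^ k * a) := by
        rw [map_mul, ← Algebra.smul_def]; exact hab
      rw [hinj hab'] at hb
      exact algebraMap_mem_powImage (base k n a hn hb)
    | succ j ih =>
      intro n z hm hn hz hxz
      have h1 := ih (n + 1) (x • z) (by omega) (by omega) (smul_mem_satPow hxI hz)
        (by rwa [smul_smul, ← pow_succ])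
      obtain ⟨a, ha, rfl⟩ := exists_algebraMap_eq_of_smul_mem hinj hxu hg h hm
        (satPow_antitone (Nat.zero_le n) hz) h1
      exact algebraMap_mem_powImage (hk₀ n hn ha)
  intro z hz
  obtain ⟨k, hk⟩ := hz
  exact key k n z hn hn' ⟨k, hk⟩ (powImage_antitone (Nat.zero_le _)
    (hk (x ^ k) (Ideal.pow_mem_pow hxI k)))

theorem smul_pow_toNat_mem {C : Type*} [CommRing C] {K : Ideal C} {y : C} (hy : y ∈ K) (n : ℤ)
    {z : C} (hz : z ∈ K ^ n.toNat) : y • z ∈ K ^ (n + 1).toNat := by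
  refine Ideal.pow_le_pow_right (show (n + 1).toNat ≤ n.toNat + 1 by omega) ?_
  rw [pow_succ', smul_eq_mul]
  exact Ideal.mul_mem_mul hy hz

/-- Multiplication by `x` is surjective from the sections of degree `n` to the sections of degree
`n + 1` modulo `I^{n+1}` for `n ≥ m`. A section `z` gives a Čech cocycle `g_i^k z / g_i^k` of the
Rees algebra of `I/xA`, and this is a coboundary. -/
theorem exists_smul_add_of_mem_satPow (hinj : Function.Injective (algebraMap A B))
    (hxu : IsUnit (algebraMap A B x)) (hg : I = Ideal.span (Set.range g))
    (h : ∀ ℓ ≥ m, GrExact (I.map (Ideal.Quotient.mk (Ideal.span {x})))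
      (fun i => Ideal.Quotient.mk (Ideal.span {x}) (g i)) ℓ)
    (hk₀ : ∀ k ≥ k₀, colonPow I x k ≤ I ^ k) {n : ℕ} (hn : m ≤ n) {z : B}
    (hz : z ∈ satPow I B (n + 1)) :
    ∃ y ∈ satPow I B n, ∃ b ∈ powImage I B (n + 1), z = x • y + b := by
  have hgI : ∀ i, g i ∈ I := fun i => hg ▸ Ideal.subset_span ⟨i, rfl⟩
  set q := Ideal.Quotient.mk (Ideal.span {x})
  have hspan : I.map q = Ideal.span (Set.range fun i => q (g i)) := by
    rw [hg, Ideal.map_span, ← Set.range_comp]; rfl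
  have hK : ∀ ℓ > (m : ℤ), KoszulExact (fun n : ℤ => ((I.map q) ^ n.toNat).toAddSubgroup)
      (fun i => q (g i)) ℓ := by
    intro ℓ hℓ c hc hdc
    obtain ⟨l, rfl⟩ : ∃ l : ℕ, ℓ = ((l + 1 : ℕ) : ℤ) := ⟨(ℓ - 1).toNat, by omega⟩
    obtain ⟨b, hb, hdb⟩ := koszulExact_pow_of_grExact hspan h (show m ≤ l by omega)
      (c := c) hc hdc
    refine ⟨b, fun J => ?_, hdb⟩
    rw [show ((l + 1 : ℕ) : ℤ) - 1 = (l : ℕ) by push_cast; ring]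
    exact hb J
  obtain ⟨e, he⟩ := hz
  replace he := smul_mem_powImage_of_le e.le_succ he
  have hgz : ∀ i, ∃ a ∈ I ^ (n + 1 + (e + 1)), algebraMap A B a = g i ^ (e + 1) • z := fun i =>
    he (g i ^ (e + 1)) (Ideal.pow_mem_pow (hgI i) _)
  choose d hd hdz using hgz
  -- the cochain with value `z` at `∅`
  let ζ : Finset (Fin r) → B := fun J => if J = ∅ then z else 0
  let c : Finset (Fin r) → A := fun J =>
    ∑ i ∈ J, if J.erase i = ∅ then d i else 0
  have hcζ : koszulD (fun i => g i ^ (e + 1)) B ζ = fun J => Algebra.linearMap A B (c J) := by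
    funext J
    rw [koszulD_apply_apply, map_sum]
    refine Finset.sum_congr rfl fun i hi => ?_
    simp only [ζ]
    split_ifs with hJ
    · have hs : koszulSign A i J = 1 := by
        rw [← koszulSign_erase_self, hJ, koszulSign, Finset.filter_empty, Finset.card_empty,
          pow_zero]
      rw [hs, one_smul]
      exact (hdz i).symm
    · simp
  have hdc : koszulD (fun i => g i ^ (e + 1)) A c = 0 := by
    funext J
    apply hinj
    have h1 := koszulD_map (Algebra.linearMap A B) (fun i => g i ^ (e + 1)) c
    rw [← hcζ, koszulD_koszulD] at h1
    rw [Pi.zero_apply, map_zero]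
    exact (congrFun h1 J).symm
  obtain ⟨b, hb, hdb⟩ := koszulExactPow_of_koszulExact
    (fun j n z hz => smul_pow_toNat_mem (Ideal.mem_map_of_mem q (hgI j)) n hz) hK (fun _ => e)
    (n + 2) (by omega) (fun J => q (c J)) (fun J => by
      change q (c J) ∈ (I.map q) ^ (_ : ℤ).toNat
      simp only [c]
      rw [map_sum]
      refine sum_mem fun i hi => ?_
      split_ifs with hJ
      · have hJ' : J = {i} := by rw [← Finset.insert_erase hi, hJ]; rfl
        rw [hJ', Finset.sum_singleton, ← Ideal.map_pow]
        refine Ideal.mem_map_of_mem q ?_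
        convert hd i using 2
        omega
      · rw [map_zero]; exact zero_mem _) (by
      have := koszulD_mk (Ideal.span {x}) (fun i => g i ^ (e + 1)) c
      rw [hdc] at this
      simp only [map_pow, Pi.zero_apply, map_zero] at this
      exact this)
  have hb0 : b ∅ ∈ (I.map q) ^ (n + 1) := by
    have h1 : b ∅ ∈ (I.map q) ^ ((n : ℤ) + 2 - 1 + ∑ _j ∈ (∅ : Finset (Fin r)), (e : ℤ)).toNat :=
      hb ∅
    rwa [Finset.sum_empty, show ((n : ℤ) + 2 - 1 + 0).toNat = n + 1 by omega] at h1
  rw [← Ideal.map_pow, Ideal.mem_map_iff_of_surjective _ Ideal.Quotient.mk_surjective] at hb0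
  obtain ⟨b₀, hb₀, hqb⟩ := hb0
  have hdiv : ∀ i, ∃ t, d i - g i ^ (e + 1) * b₀ = x * t := fun i => by
    have h1 := congrFun hdb {i}
    rw [koszulD_apply_apply, Finset.sum_singleton, Finset.erase_singleton, ← hqb] at h1
    have hs : koszulSign (A ⧸ Ideal.span {x}) i {i} = 1 := by
      rw [← koszulSign_erase_self, Finset.erase_singleton, koszulSign, Finset.filter_empty,
        Finset.card_empty, pow_zero]
    have hc1 : c {i} = d i := by
      simp only [c]
      rw [Finset.sum_singleton, if_pos (Finset.erase_singleton i)]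
    rw [hs, one_smul, hc1, smul_eq_mul, ← map_pow, ← map_mul, eq_comm, Ideal.Quotient.eq,
      Ideal.mem_span_singleton] at h1
    exact h1
  choose t ht using hdiv
  obtain ⟨y, hy⟩ : ∃ y : B, z - algebraMap A B b₀ = x • y := by
    obtain ⟨v, hv⟩ := hxu.exists_right_inv
    refine ⟨v * (z - algebraMap A B b₀), ?_⟩
    rw [Algebra.smul_def, ← mul_assoc, hv, one_mul]
  have hgy : ∀ i, g i ^ (e + 1) • y = algebraMap A B (t i) := fun i => by
    apply hxu.mul_left_cancel
    rw [← map_mul, ← ht, map_sub, hdz, map_mul, ← Algebra.smul_def, smul_comm, ← hy, smul_sub,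
      Algebra.smul_def _ (algebraMap A B b₀)]
  -- the ideal of denominators of `y` contains a power of `I`
  let 𝔞 : Ideal A := Submodule.comap (LinearMap.toSpanSingleton A B y) (powImage I B 0)
  have hrad : I ≤ 𝔞.radical := by
    rw [hg, Ideal.span_le]
    rintro _ ⟨i, rfl⟩
    refine ⟨e + 1, ?_⟩
    change g i ^ (e + 1) • y ∈ powImage I B 0
    rw [hgy]
    exact algebraMap_mem_powImage (by simp)
  obtain ⟨K, hK'⟩ := Ideal.exists_pow_le_of_le_radical_of_fg hrad (IsNoetherian.noetherian I)
  have hyx : x • y ∈ satPow I B (n + 1) := by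
    rw [← hy]
    exact sub_mem ⟨_, he⟩ (powImage_le_satPow _ (algebraMap_mem_powImage hb₀))
  refine ⟨y, mem_satPow_of_smul_mem hinj hk₀ (k := K) (fun u hu => hK' hu) hyx, _,
    algebraMap_mem_powImage hb₀, ?_⟩
  rw [← hy, sub_add_cancel]

end Exact

end Saturation

/-! ### Lengths of the quotients of the modules of sections -/

section Length

variable {A : Type*} [CommRing A] {M N : Type*} [AddCommGroup M] [Module A M] [AddCommGroup N]
  [Module A N]

theorem length_eq_ker_add_range (f : M →ₗ[A] N) :
    Module.length A M = Module.length A (LinearMap.ker f) + Module.length A (LinearMap.range f) :=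
  Module.length_eq_add_of_exact (LinearMap.ker f).subtype f.rangeRestrict
    (Submodule.subtype_injective _) (LinearMap.surjective_rangeRestrict f) (by
      rw [LinearMap.exact_iff, LinearMap.ker_rangeRestrict, Submodule.range_subtype])

theorem length_eq_submodule_add_quotient (P : Submodule A M) :
    Module.length A M = Module.length A P + Module.length A (M ⧸ P) :=
  Module.length_eq_add_of_exact P.subtype P.mkQ (Submodule.subtype_injective _)
    (Submodule.mkQ_surjective _) (by
      rw [LinearMap.exact_iff, Submodule.ker_mkQ, Submodule.range_subtype])

/-- The kernel and the cokernel of an endomorphism of a module of finite length have the same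
length. -/
theorem length_quotient_range_eq_length_ker {f : M →ₗ[A] M} (h : Module.length A M ≠ ⊤) :
    Module.length A (M ⧸ LinearMap.range f) = Module.length A (LinearMap.ker f) := by
  have h1 := length_eq_ker_add_range f
  have h2 := length_eq_submodule_add_quotient (LinearMap.range f)
  have h3 : Module.length A (LinearMap.range f) ≠ ⊤ := fun h3 => h (by rw [h1, h3, add_top])
  rw [h1, add_comm] at h2
  exact ((WithTop.add_left_inj h3).mp h2).symm

theorem length_ne_top_of_pow_eq_zero {f : M →ₗ[A] M} (hf : Module.length A (LinearMap.ker f) ≠ ⊤)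
    {j : ℕ} (hj : f ^ j = 0) : Module.length A M ≠ ⊤ := by
  have key : ∀ j, Module.length A (LinearMap.ker (f ^ j)) ≠ ⊤ := by
    intro j
    induction j with
    | zero =>
      have : Subsingleton (LinearMap.ker (f ^ 0)) := by
        rw [pow_zero, Submodule.subsingleton_iff_eq_bot, Module.End.one_eq_id, LinearMap.ker_id]
      rw [Module.length_eq_zero]
      exact ENat.zero_ne_top
    | succ j ih =>
      let φ : LinearMap.ker (f ^ (j + 1)) →ₗ[A] LinearMap.ker (f ^ j) :=
        f.restrict fun z hz => by
          rw [LinearMap.mem_ker] at hz ⊢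
          rwa [pow_succ, Module.End.mul_apply] at hz
      rw [length_eq_ker_add_range φ]
      refine WithTop.add_ne_top.mpr ⟨ne_top_of_le_ne_top hf ?_, ne_top_of_le_ne_top ih
        (Module.length_le_of_injective (Submodule.subtype _) (Submodule.subtype_injective _))⟩
      let ψ : LinearMap.ker φ →ₗ[A] LinearMap.ker f :=
        (Submodule.subtype _ ∘ₗ Submodule.subtype _).codRestrict _ fun z => by
          have := z.2
          rw [LinearMap.mem_ker] at this ⊢
          exact congrArg Subtype.val this
      exact Module.length_le_of_injective ψ fun z w hzw =>
        Subtype.ext (Subtype.ext (show (ψ z : M) = ψ w by rw [hzw]))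
  have h1 := key j
  rw [hj, LinearMap.ker_zero, Module.length_top] at h1
  exact h1

theorem lsmul_pow_apply (a : A) (j : ℕ) (z : M) : (LinearMap.lsmul A M a ^ j) z = a ^ j • z := by
  induction j with
  | zero => simp
  | succ j ih =>
    rw [pow_succ', Module.End.mul_apply, ih, pow_succ', mul_smul, LinearMap.lsmul_apply]

end Length

section Bound

variable {A : Type*} [CommRing A] {I : Ideal A} {B : Type*} [CommRing B] [Algebra A B] {x : A}
  {m : ℕ}

variable (I B) in
/-- The quotient of the sections of degree `n` by those of degree `n + 1` and by `I^n`. It is the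
kernel of the map from the first local cohomology of `gr_I(A)` in degree `n` to the second one of
the Rees algebra. -/
abbrev SatQuotient (n : ℕ) : Type _ :=
  satPow I B n ⧸ (satPow I B (n + 1) ⊔ powImage I B n).submoduleOf (satPow I B n)

variable (I B) in
/-- The quotient `Γ_n / I^{n+1}` of the sections of degree `n`. -/
abbrev SatPowQuotient (n : ℕ) : Type _ :=
  satPow I B n ⧸ (powImage I B (n + 1)).submoduleOf (satPow I B n)

theorem pow_smul_mem_satPow (hxI : x ∈ I) {n : ℕ} (j : ℕ) {z : B} (hz : z ∈ satPow I B n) :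
    x ^ j • z ∈ satPow I B (n + j) := by
  induction j with
  | zero => simpa using hz
  | succ j ih =>
    rw [pow_succ', mul_smul]
    exact smul_mem_satPow hxI ih

theorem length_satQuotient_le_length_quotient_range (hxI : x ∈ I) :
    Module.length A (SatQuotient I B m) ≤ Module.length A
      (SatPowQuotient I B m ⧸ LinearMap.range (LinearMap.lsmul A (SatPowQuotient I B m) x)) := by
  let π : SatPowQuotient I B m →ₗ[A] SatQuotient I B m :=
    Submodule.mapQ _ _ LinearMap.id fun z hz =>
      Submodule.mem_sup_right (powImage_antitone m.le_succ hz)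
  have hπ : LinearMap.range (LinearMap.lsmul A (SatPowQuotient I B m) x) ≤ LinearMap.ker π := by
    rintro _ ⟨z, rfl⟩
    obtain ⟨z, rfl⟩ := Submodule.Quotient.mk_surjective _ z
    rw [LinearMap.mem_ker, LinearMap.lsmul_apply, ← Submodule.Quotient.mk_smul]
    exact (Submodule.Quotient.mk_eq_zero _).mpr
      (Submodule.mem_sup_left (smul_mem_satPow hxI z.2))
  refine Module.length_le_of_surjective ((LinearMap.range _).liftQ π hπ) fun z => ?_
  obtain ⟨z, rfl⟩ := Submodule.Quotient.mk_surjective _ z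
  exact ⟨Submodule.Quotient.mk (Submodule.Quotient.mk z), rfl⟩

theorem length_quotient_range_lsmul_le (J : Ideal A) :
    Module.length A ((A ⧸ J) ⧸ LinearMap.range (LinearMap.lsmul A (A ⧸ J) x)) ≤
      Module.length A (A ⧸ (J ⊔ Ideal.span {x})) := by
  have hJ : J ⊔ Ideal.span {x} ≤
      LinearMap.ker ((LinearMap.range (LinearMap.lsmul A (A ⧸ J) x)).mkQ ∘ₗ J.mkQ) := by
    refine sup_le (fun a ha => ?_) ?_
    · rw [LinearMap.mem_ker, LinearMap.comp_apply, Submodule.mkQ_apply J,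
        (Submodule.Quotient.mk_eq_zero J).mpr ha, map_zero]
    · rw [Ideal.span_le, Set.singleton_subset_iff]
      refine LinearMap.mem_ker.mpr ((Submodule.Quotient.mk_eq_zero _).mpr ?_)
      refine ⟨J.mkQ 1, ?_⟩
      rw [LinearMap.lsmul_apply, ← map_smul, smul_eq_mul, mul_one]
  refine Module.length_le_of_surjective (Submodule.liftQ _ _ hJ) fun z => ?_
  obtain ⟨z, rfl⟩ := Submodule.Quotient.mk_surjective _ z
  obtain ⟨z, rfl⟩ := Submodule.Quotient.mk_surjective _ z
  exact ⟨Submodule.Quotient.mk z, rfl⟩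

variable [IsNoetherianRing A] {r : ℕ} {g : Fin r → A} {k₀ : ℕ}

/-- Both kernels consist of the classes of the elements of `I^{m+1} : x`. -/
theorem length_ker_lsmul_satPowQuotient_le (hinj : Function.Injective (algebraMap A B))
    (hxu : IsUnit (algebraMap A B x)) (hg : I = Ideal.span (Set.range g))
    (h : ∀ ℓ ≥ m, GrExact (I.map (Ideal.Quotient.mk (Ideal.span {x})))
      (fun i => Ideal.Quotient.mk (Ideal.span {x}) (g i)) ℓ)
    (hk₀ : ∀ k ≥ k₀, colonPow I x k ≤ I ^ k) :
    Module.length A (LinearMap.ker (LinearMap.lsmul A (SatPowQuotient I B m) x)) ≤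
      Module.length A (LinearMap.ker (LinearMap.lsmul A (A ⧸ I ^ (m + 1)) x)) := by
  let u : colonPow I x m →ₗ[A] LinearMap.ker (LinearMap.lsmul A (A ⧸ I ^ (m + 1)) x) :=
    ((I ^ (m + 1)).mkQ ∘ₗ Submodule.subtype _).codRestrict _ fun a => by
      rw [LinearMap.mem_ker, LinearMap.lsmul_apply, LinearMap.comp_apply, ← map_smul,
        Submodule.mkQ_apply, Submodule.Quotient.mk_eq_zero]
      exact a.2
  let w : colonPow I x m →ₗ[A] satPow I B m :=
    (Algebra.linearMap A B ∘ₗ Submodule.subtype _).codRestrict _ fun a =>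
      algebraMap_mem_satPow_of_mem_colonPow hk₀ a.2
  let v : colonPow I x m →ₗ[A] LinearMap.ker (LinearMap.lsmul A (SatPowQuotient I B m) x) :=
    (((powImage I B (m + 1)).submoduleOf (satPow I B m)).mkQ ∘ₗ w).codRestrict _ fun a => by
      rw [LinearMap.mem_ker, LinearMap.lsmul_apply, LinearMap.comp_apply, ← map_smul,
        Submodule.mkQ_apply, Submodule.Quotient.mk_eq_zero]
      change x • algebraMap A B (a : A) ∈ powImage I B (m + 1)
      rw [Algebra.smul_def, ← map_mul]
      exact algebraMap_mem_powImage a.2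
  have hv : Function.Surjective v := by
    rintro ⟨z, hz⟩
    obtain ⟨z, rfl⟩ := Submodule.Quotient.mk_surjective _ z
    rw [LinearMap.mem_ker, LinearMap.lsmul_apply, ← Submodule.Quotient.mk_smul,
      Submodule.Quotient.mk_eq_zero] at hz
    obtain ⟨a, ha, haz⟩ := exists_algebraMap_eq_of_smul_mem hinj hxu hg h le_rfl
      (satPow_antitone (Nat.zero_le m) z.2) hz
    exact ⟨⟨a, ha⟩, Subtype.ext (congrArg Submodule.Quotient.mk (Subtype.ext haz))⟩
  have huv : LinearMap.ker u ≤ LinearMap.ker v := fun a ha => by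
    have h1 : (a : A) ∈ I ^ (m + 1) := (Submodule.Quotient.mk_eq_zero _).mp
      (congrArg Subtype.val (LinearMap.mem_ker.mp ha))
    exact LinearMap.mem_ker.mpr (Subtype.ext
      ((Submodule.Quotient.mk_eq_zero _).mpr (algebraMap_mem_powImage h1)))
  refine (Module.length_le_of_surjective ((LinearMap.ker u).liftQ v huv) fun z => ?_).trans
    (Module.length_le_of_injective ((LinearMap.ker u).liftQ u le_rfl) ?_)
  · obtain ⟨a, ha⟩ := hv z
    exact ⟨Submodule.Quotient.mk a, by rw [← ha]; rfl⟩
  · rw [← LinearMap.ker_eq_bot]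
    exact Submodule.ker_liftQ_eq_bot _ _ _ le_rfl

theorem exists_lsmul_pow_satPowQuotient_eq_zero (hxI : x ∈ I)
    (hinj : Function.Injective (algebraMap A B))
    (hxu : IsUnit (algebraMap A B x)) (hg : I = Ideal.span (Set.range g))
    (h : ∀ ℓ ≥ m, GrExact (I.map (Ideal.Quotient.mk (Ideal.span {x})))
      (fun i => Ideal.Quotient.mk (Ideal.span {x}) (g i)) ℓ)
    (hk₀ : ∀ k ≥ k₀, colonPow I x k ≤ I ^ k) :
    ∃ j, LinearMap.lsmul A (SatPowQuotient I B m) x ^ j = 0 := by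
  refine ⟨k₀ + 1, ?_⟩
  refine LinearMap.ext fun z => ?_
  obtain ⟨z, rfl⟩ := Submodule.Quotient.mk_surjective _ z
  rw [lsmul_pow_apply, ← Submodule.Quotient.mk_smul, LinearMap.zero_apply,
    Submodule.Quotient.mk_eq_zero]
  refine powImage_antitone (show m + 1 ≤ m + (k₀ + 1) by omega) ?_
  exact satPow_le_powImage_of_ge hxI hinj hxu hg h hk₀ (by omega) (by omega)
    (pow_smul_mem_satPow hxI _ z.2)

/-- The length of `Γ_m / (Γ_{m+1} + I^m)` is bounded by that of `A / (I^{m+1} + xA)`: on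
`Γ_m / I^{m+1}` and on `A / I^{m+1}` multiplication by `x` has kernel and cokernel of equal lengths,
and the two kernels agree. -/
theorem length_satQuotient_le (hxI : x ∈ I) (hinj : Function.Injective (algebraMap A B))
    (hxu : IsUnit (algebraMap A B x)) (hg : I = Ideal.span (Set.range g))
    (h : ∀ ℓ ≥ m, GrExact (I.map (Ideal.Quotient.mk (Ideal.span {x})))
      (fun i => Ideal.Quotient.mk (Ideal.span {x}) (g i)) ℓ)
    (hk₀ : ∀ k ≥ k₀, colonPow I x k ≤ I ^ k)
    (hfin : Module.length A (A ⧸ I ^ (m + 1)) ≠ ⊤) :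
    Module.length A (SatQuotient I B m)
      ≤ Module.length A (A ⧸ (I ^ (m + 1) ⊔ Ideal.span {x})) := by
  have hker := length_ker_lsmul_satPowQuotient_le (B := B) hinj hxu hg h hk₀
  have hkerfin : Module.length A (LinearMap.ker (LinearMap.lsmul A (A ⧸ I ^ (m + 1)) x)) ≠ ⊤ :=
    ne_top_of_le_ne_top hfin
      (Module.length_le_of_injective (Submodule.subtype _) (Submodule.subtype_injective _))
  obtain ⟨j, hj⟩ := exists_lsmul_pow_satPowQuotient_eq_zero hxI hinj hxu hg h hk₀
  calc Module.length A (SatQuotient I B m)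
      ≤ _ := length_satQuotient_le_length_quotient_range hxI
    _ = _ := length_quotient_range_eq_length_ker
        (length_ne_top_of_pow_eq_zero (ne_top_of_le_ne_top hkerfin hker) hj)
    _ ≤ _ := hker
    _ = _ := (length_quotient_range_eq_length_ker hfin).symm
    _ ≤ _ := length_quotient_range_lsmul_le _

/-- The quotients `Γ_n / (Γ_{n+1} + I^n)` vanish from `n = m + λ(A / (I^{m+1} + xA))` on. For
`n ≥ m` multiplication by `x` maps each of them onto the next, and its kernel consists of the
classes of the elements of `I^{n+1} : x`. If it is injective on one of them, then also on all later
ones, since `I^{n+1} : x` generates `I^{n+2} : x`, and then the quotient is zero, because the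
quotients vanish for large `n`. So their lengths decrease strictly until they are zero. -/
theorem colonPow_le_pow_of_ge (hxI : x ∈ I) (hinj : Function.Injective (algebraMap A B))
    (hxu : IsUnit (algebraMap A B x)) (hg : I = Ideal.span (Set.range g))
    (h : ∀ ℓ ≥ m, GrExact (I.map (Ideal.Quotient.mk (Ideal.span {x})))
      (fun i => Ideal.Quotient.mk (Ideal.span {x}) (g i)) ℓ)
    (hk₀ : ∀ k ≥ k₀, colonPow I x k ≤ I ^ k)
    (hfin : Module.length A (A ⧸ I ^ (m + 1)) ≠ ⊤) {H : ℕ}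
    (hH : Module.length A (A ⧸ (I ^ (m + 1) ⊔ Ideal.span {x})) ≤ H) {n : ℕ} (hn : m + H ≤ n) :
    colonPow I x n ≤ I ^ n := by
  -- if the classes of `I^{n+1} : x` vanish, so do those of `I^{n+2} : x`
  have hJI : ∀ n ≥ m, (∀ a ∈ colonPow I x n,
      algebraMap A B a ∈ satPow I B (n + 1) ⊔ powImage I B n) → ∀ a ∈ colonPow I x (n + 1),
      algebraMap A B a ∈ satPow I B (n + 1 + 1) ⊔ powImage I B (n + 1) := by
    intro n hn hJ a ha
    have ha' := colonPow_succ_le_mul hxI hg h hk₀ hn ha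
    clear ha
    induction ha' using Submodule.mul_induction_on' with
    | mem_mul_mem u hu b hb =>
      obtain ⟨z, hz, w, hw, hzw⟩ := Submodule.mem_sup.mp (hJ b hb)
      rw [map_mul, ← Algebra.smul_def, ← hzw, smul_add, add_comm n 1]
      refine Submodule.add_mem_sup ?_ ?_
      · rw [add_comm 1 n]; exact smul_mem_satPow hu hz
      · exact smul_mem_powImage (by rwa [pow_one]) hw
    | add a _ b _ ha hb => rw [map_add]; exact add_mem ha hb
  have hZlarge : ∀ n, m ≤ n → k₀ ≤ n → satPow I B n ≤ satPow I B (n + 1) ⊔ powImage I B n :=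
    fun n h1 h2 => (satPow_le_powImage_of_ge hxI hinj hxu hg h hk₀ h1 h2).trans le_sup_right
  -- the kernel of multiplication by `x`
  have hkerx : ∀ n ≥ m, ∀ z ∈ satPow I B n, x • z ∈ satPow I B (n + 1 + 1) ⊔ powImage I B (n + 1) →
      ∃ a ∈ colonPow I x n, ∃ y ∈ satPow I B (n + 1), z = algebraMap A B a + y := by
    intro n hn z hz hxz
    obtain ⟨f, hf, b, hb, hfb⟩ := Submodule.mem_sup.mp hxz
    obtain ⟨y, hy, b', hb', rfl⟩ := exists_smul_add_of_mem_satPow hinj hxu hg h hk₀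
      (by omega) hf
    have h1 : x • (z - y) ∈ powImage I B (n + 1) := by
      rw [smul_sub, ← hfb, add_assoc, add_sub_cancel_left]
      exact add_mem (powImage_antitone (Nat.le_succ _) hb') hb
    obtain ⟨a, ha, haz⟩ := exists_algebraMap_eq_of_smul_mem hinj hxu hg h hn
      (satPow_antitone (Nat.zero_le n) (sub_mem hz (satPow_antitone n.le_succ hy))) h1
    exact ⟨a, ha, y, hy, by rw [haz, sub_add_cancel]⟩
  -- if multiplication by `x` is injective on a quotient, this quotient is zero
  have hstab : ∀ n ≥ m, (∀ a ∈ colonPow I x n,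
      algebraMap A B a ∈ satPow I B (n + 1) ⊔ powImage I B n) →
      satPow I B n ≤ satPow I B (n + 1) ⊔ powImage I B n := by
    have key : ∀ k n, m ≤ n → k₀ ≤ n + k → (∀ a ∈ colonPow I x n,
      algebraMap A B a ∈ satPow I B (n + 1) ⊔ powImage I B n) →
      satPow I B n ≤ satPow I B (n + 1) ⊔ powImage I B n := by
      intro k
      induction k with
      | zero => exact fun n h1 h2 _ => hZlarge n h1 h2
      | succ k ih =>
        intro n hn hk hJ z hz
        have h1 := ih (n + 1) (by omega) (by omega) (hJI n hn hJ) (smul_mem_satPow hxI hz)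
        obtain ⟨a, ha, y, hy, rfl⟩ := hkerx n hn z hz h1
        exact add_mem (hJ a ha) (Submodule.mem_sup_left hy)
    exact fun n hn => key k₀ n hn (by omega)
  have hnext : ∀ n ≥ m, satPow I B n ≤ satPow I B (n + 1) ⊔ powImage I B n →
      satPow I B (n + 1) ≤ satPow I B (n + 1 + 1) ⊔ powImage I B (n + 1) := by
    intro n hn hZ z hz
    obtain ⟨y, hy, b, hb, rfl⟩ := exists_smul_add_of_mem_satPow hinj hxu hg h hk₀ hn hz
    obtain ⟨f, hf, w, hw, rfl⟩ := Submodule.mem_sup.mp (hZ hy)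
    rw [smul_add, add_assoc (x • f)]
    refine Submodule.add_mem_sup (smul_mem_satPow hxI hf) (add_mem ?_ hb)
    rw [add_comm n 1]
    exact smul_mem_powImage (by rwa [pow_one]) hw
  -- the lengths decrease strictly
  have hlen : ∀ n ≥ m, ¬ satPow I B n ≤ satPow I B (n + 1) ⊔ powImage I B n →
      Module.length A (SatQuotient I B (n + 1)) + 1 ≤ Module.length A (SatQuotient I B n) := by
    intro n hn hZ
    let f : SatQuotient I B n →ₗ[A] SatQuotient I B (n + 1) :=
      Submodule.mapQ _ _ ((LinearMap.lsmul A B x).restrict fun z hz => smul_mem_satPow hxI hz)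
        (by
          intro z hz
          obtain ⟨f, hf, w, hw, hfw⟩ := Submodule.mem_sup.mp (show (z : B) ∈ _ from hz)
          change x • (z : B) ∈ satPow I B (n + 1 + 1) ⊔ powImage I B (n + 1)
          rw [← hfw, smul_add]
          refine Submodule.add_mem_sup (smul_mem_satPow hxI hf) ?_
          rw [add_comm n 1]
          exact smul_mem_powImage (by rwa [pow_one]) hw)
    have hf : Function.Surjective f := by
      intro z
      obtain ⟨⟨z, hz⟩, rfl⟩ := Submodule.Quotient.mk_surjective _ z
      obtain ⟨y, hy, b, hb, hyb⟩ := exists_smul_add_of_mem_satPow hinj hxu hg h hk₀ hn hz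
      refine ⟨Submodule.Quotient.mk ⟨y, hy⟩, ?_⟩
      change Submodule.Quotient.mk _ = Submodule.Quotient.mk _
      rw [eq_comm, Submodule.Quotient.eq]
      change z - x • y ∈ satPow I B (n + 1 + 1) ⊔ powImage I B (n + 1)
      rw [hyb, add_sub_cancel_left]
      exact Submodule.mem_sup_right hb
    have hnontriv : Nontrivial (LinearMap.ker f) := by
      rw [Submodule.nontrivial_iff_ne_bot]
      intro hbot
      refine hZ (hstab n hn fun a ha => ?_)
      have h1 : Submodule.Quotient.mk ⟨algebraMap A B a,
          algebraMap_mem_satPow_of_mem_colonPow hk₀ ha⟩ ∈ LinearMap.ker f := by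
        rw [LinearMap.mem_ker]
        change Submodule.Quotient.mk _ = 0
        rw [Submodule.Quotient.mk_eq_zero]
        refine Submodule.mem_sup_right ?_
        change x • algebraMap A B a ∈ _
        rw [Algebra.smul_def, ← map_mul]
        exact algebraMap_mem_powImage ha
      rw [hbot, Submodule.mem_bot, Submodule.Quotient.mk_eq_zero] at h1
      exact h1
    rw [length_eq_ker_add_range f, LinearMap.range_eq_top.mpr hf, Module.length_top, add_comm]
    exact add_le_add_left (Order.one_le_iff_pos.mpr Module.length_pos) _
  have hZ : ∀ n ≥ m + H, satPow I B n ≤ satPow I B (n + 1) ⊔ powImage I B n := by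
    have hdich : ∀ i, satPow I B (m + i) ≤ satPow I B (m + i + 1) ⊔ powImage I B (m + i) ∨
        Module.length A (SatQuotient I B (m + i)) + i ≤ Module.length A (SatQuotient I B m) := by
      intro i
      induction i with
      | zero => right; simp
      | succ i ih =>
        by_cases hZi : satPow I B (m + i) ≤ satPow I B (m + i + 1) ⊔ powImage I B (m + i)
        · exact Or.inl (hnext (m + i) (by omega) hZi)
        · right
          refine le_trans ?_ (ih.resolve_left hZi)
          rw [Nat.cast_succ, add_comm (i : ℕ∞), ← add_assoc]
          exact add_le_add_left (hlen (m + i) (by omega) hZi) _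
    have hend : satPow I B (m + H) ≤ satPow I B (m + H + 1) ⊔ powImage I B (m + H) := by
      rcases hdich H with h1 | h1
      · exact h1
      · have h2 := (h1.trans (length_satQuotient_le hxI hinj hxu hg h hk₀ hfin)).trans hH
        have h3 : Module.length A (SatQuotient I B (m + H)) = 0 := by
          have h4 : Module.length A (SatQuotient I B (m + H)) + H ≤ 0 + H := by
            rwa [zero_add]
          exact nonpos_iff_eq_zero.mp
            ((ENat.add_le_add_iff_right (ENat.natCast_ne_top H)).mp h4)
        rw [Module.length_eq_zero_iff, Submodule.Quotient.subsingleton_iff] at h3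
        intro z hz
        have : (⟨z, hz⟩ : satPow I B (m + H)) ∈ (⊤ : Submodule A (satPow I B (m + H))) := trivial
        rw [← h3] at this
        exact this
    intro n hn
    induction n, hn using Nat.le_induction with
    | base => exact hend
    | succ n hn ih => exact hnext n (by omega) ih
  -- the vanishing of the quotients gives `Γ_n = I^n` by descent from large degrees
  have hΓ : ∀ k n, m + H ≤ n → k₀ ≤ n + k → satPow I B n ≤ powImage I B n := by
    intro k
    induction k with
    | zero => exact fun n h1 h2 => satPow_le_powImage_of_ge hxI hinj hxu hg h hk₀ (by omega) h2
    | succ k ih =>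
      intro n h1 h2
      refine (hZ n h1).trans (sup_le ?_ le_rfl)
      exact (ih (n + 1) (by omega) (by omega)).trans (powImage_antitone n.le_succ)
  intro a ha
  obtain ⟨b, hb, hab⟩ := hΓ k₀ n hn (by omega) (algebraMap_mem_satPow_of_mem_colonPow hk₀ ha)
  rwa [← hinj hab]

end Bound

/-! ### Hilbert functions and superficial elements -/

section Hilbert

variable {A : Type*} [CommRing A]

theorem length_quotient_pow_succ (I : Ideal A) (n : ℕ) :
    Module.length A (A ⧸ I ^ (n + 1)) =
      Module.length A (grComponent I n) + Module.length A (A ⧸ I ^ n) := by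
  let φ : ↥(I ^ n) →ₗ[A] A ⧸ I ^ (n + 1) := (I ^ (n + 1)).mkQ ∘ₗ (I ^ n).subtype
  have hker : LinearMap.ker φ = LinearMap.ker (toGr I n) := by
    ext a
    rw [LinearMap.mem_ker, LinearMap.mem_ker, toGr_eq_zero_iff]
    exact Submodule.Quotient.mk_eq_zero _
  have hrange : Module.length A (LinearMap.range φ) = Module.length A (grComponent I n) := by
    rw [← range_toGr, ← (LinearMap.quotKerEquivRange φ).length_eq,
      ← (LinearMap.quotKerEquivRange (toGr I n)).length_eq, hker]
  have hle : I ^ (n + 1) ≤ I ^ n := Ideal.pow_le_pow_right n.le_succ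
  rw [← hrange]
  refine Module.length_eq_add_of_exact (LinearMap.range φ).subtype (Submodule.factor hle)
    (Submodule.subtype_injective _) (Submodule.factor_surjective hle) ?_
  rw [LinearMap.exact_iff, Submodule.range_subtype]
  ext z
  obtain ⟨z, rfl⟩ := Submodule.Quotient.mk_surjective _ z
  rw [LinearMap.mem_ker]
  change Submodule.Quotient.mk z = 0 ↔ _
  rw [Submodule.Quotient.mk_eq_zero]
  constructor
  · exact fun hz => ⟨⟨z, hz⟩, rfl⟩
  · rintro ⟨w, hw⟩
    have h1 : z - (w : A) ∈ I ^ (n + 1) := (Submodule.Quotient.eq _).mp hw.symm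
    have h2 := add_mem (hle h1) w.2
    rwa [sub_add_cancel] at h2

theorem length_quotient_pow_eq_sum (I : Ideal A) (n : ℕ) :
    Module.length A (A ⧸ I ^ n) = ∑ j ∈ Finset.range n, Module.length A (grComponent I j) := by
  induction n with
  | zero =>
    have : Subsingleton (A ⧸ I ^ 0) := by
      rw [Submodule.Quotient.subsingleton_iff, pow_zero, Ideal.one_eq_top]
    rw [Finset.sum_range_zero, Module.length_eq_zero]
  | succ n ih => rw [length_quotient_pow_succ, ih, Finset.sum_range_succ, add_comm]

variable [IsNoetherianRing A] (I : Ideal A) [I.IsMaximal]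

theorem length_grComponent_ne_top (n : ℕ) : Module.length A (grComponent I n) ≠ ⊤ := by
  have hle : I • (⊤ : Submodule A ↥(I ^ n)) ≤ LinearMap.ker (toGr I n) := by
    rw [Submodule.smul_le]
    intro a ha z _
    rw [LinearMap.mem_ker, toGr_eq_zero_iff, pow_succ']
    exact Ideal.mul_mem_mul ha z.2
  rw [← range_toGr, ← (LinearMap.quotKerEquivRange (toGr I n)).length_eq]
  -- the quotient of `I^n` by `I • I^n` is a finite-dimensional vector space over `A / I`
  refine ne_top_of_le_ne_top ?_ (Module.length_le_of_surjective (Submodule.factor hle)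
    (Submodule.factor_surjective hle))
  let : Field (A ⧸ I) := Ideal.Quotient.field I
  have : Module.Finite (A ⧸ I) (↥(I ^ n) ⧸ I • (⊤ : Submodule A ↥(I ^ n))) :=
    Module.Finite.of_restrictScalars_finite A _ _
  rw [Module.length_eq_of_surjective (R := A ⧸ I) (S := A) Ideal.Quotient.mk_surjective,
    Module.length_eq_finrank]
  exact ENat.natCast_ne_top _

theorem length_quotient_pow_ne_top (n : ℕ) : Module.length A (A ⧸ I ^ n) ≠ ⊤ := by
  rw [length_quotient_pow_eq_sum]
  exact WithTop.sum_ne_top.mpr fun j _ => length_grComponent_ne_top I j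

theorem length_quotient_pow_eq_hilbertFn1 (n : ℕ) :
    Module.length A (A ⧸ I ^ (n + 1)) = hilbertFn1 I n := by
  rw [length_quotient_pow_eq_sum, hilbertFn1, Nat.cast_sum]
  exact Finset.sum_congr rfl fun j _ => (ENat.natCast_toNat (length_grComponent_ne_top I j)).symm

end Hilbert

theorem length_quotient_sup_le {A : Type*} [CommRing A] (I : Ideal A) (x : A) (n : ℕ) :
    Module.length A (A ⧸ (I ^ n ⊔ Ideal.span {x})) ≤
      Module.length (A ⧸ Ideal.span {x})
        ((A ⧸ Ideal.span {x}) ⧸ I.map (Ideal.Quotient.mk (Ideal.span {x})) ^ n) := by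
  set K := I.map (Ideal.Quotient.mk (Ideal.span {x})) ^ n
  rw [← Module.length_eq_of_surjective (R := A ⧸ Ideal.span {x}) (S := A)
    Ideal.Quotient.mk_surjective]
  let f : A →ₗ[A] (A ⧸ Ideal.span {x}) ⧸ K := Algebra.linearMap A _
  have hker : LinearMap.ker f = I ^ n ⊔ Ideal.span {x} := by
    ext a
    rw [LinearMap.mem_ker]
    change Ideal.Quotient.mk K (Ideal.Quotient.mk (Ideal.span {x}) a) = 0 ↔ _
    rw [Ideal.Quotient.eq_zero_iff_mem]
    exact mk_mem_map_pow_iff I x a n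
  refine Module.length_le_of_injective (Submodule.liftQ _ f hker.ge) ?_
  rw [← LinearMap.ker_eq_bot]
  exact Submodule.ker_liftQ_eq_bot _ _ _ hker.le

section Superficial

variable {A : Type*} [CommRing A] [IsLocalRing A]

theorem exists_isSMulRegular_of_depth_pos (h : 0 < depth A) :
    ∃ y ∈ IsLocalRing.maximalIdeal A, IsSMulRegular A y := by
  obtain ⟨s, hs⟩ := lt_iSup_iff.mp h
  obtain ⟨⟨hmem, hreg⟩, hlen⟩ := lt_iSup_iff.mp hs
  cases s with
  | nil => simp at hlen
  | cons y t =>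
    exact ⟨y, hmem y (by simp), ((RingTheory.Sequence.isWeaklyRegular_cons_iff A y t).mp
      hreg.toIsWeaklyRegular).1⟩

variable [IsNoetherianRing A]

/-- A superficial element `x` is a nonzerodivisor if the depth is positive: if `x a = 0`, then
`y^c a` lies in all powers of the maximal ideal for `y ∈ 𝔪`. -/
theorem IsSuperficial.mem_nonZeroDivisors {x : A} (hx : IsSuperficial x) (h : 0 < depth A) :
    x ∈ nonZeroDivisors A := by
  obtain ⟨y, hy, hreg⟩ := exists_isSMulRegular_of_depth_pos h
  obtain ⟨-, c, hc⟩ := hx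
  rw [mem_nonZeroDivisors_iff_right]
  intro a ha
  have h1 : y ^ c * a ∈ ⨅ n, IsLocalRing.maximalIdeal A ^ n := by
    rw [Submodule.mem_iInf]
    intro n
    refine Ideal.pow_le_pow_right (le_max_left n c) ((hc _ (le_max_right n c) _).mp ⟨?_, ?_⟩)
    · rw [mul_left_comm, mul_comm x, ha, mul_zero]
      exact zero_mem _
    · exact Ideal.mul_mem_right _ _ (Ideal.pow_mem_pow hy c)
  rw [Ideal.iInf_pow_eq_bot_of_isLocalRing _ (Ideal.IsPrime.ne_top'), Submodule.mem_bot] at h1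
  exact (hreg.pow c) (show y ^ c • a = y ^ c • 0 by rw [smul_eq_mul, h1, smul_zero])

/-- For `k` large, `𝔪^{k+1} : x ⊆ 𝔪^k`: by the Artin–Rees lemma the left side lies in `𝔪^c`. -/
theorem IsSuperficial.exists_colonPow_le {x : A} (hx : IsSuperficial x)
    (hreg : x ∈ nonZeroDivisors A) :
    ∃ k₀, ∀ k ≥ k₀, colonPow (IsLocalRing.maximalIdeal A) x k ≤ IsLocalRing.maximalIdeal A ^ k := by
  obtain ⟨-, c, hc⟩ := hx
  obtain ⟨l, hl⟩ := Ideal.exists_pow_inf_eq_pow_smul (IsLocalRing.maximalIdeal A)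
    (Ideal.span {x} : Submodule A A)
  refine ⟨l + c, fun k hk a ha => (hc k (by omega) a).mp ⟨ha, ?_⟩⟩
  have h1 : x * a ∈ IsLocalRing.maximalIdeal A ^ (k + 1 - l) * Ideal.span {x} := by
    have h2 : x * a ∈ IsLocalRing.maximalIdeal A ^ (k + 1) • (⊤ : Submodule A A) ⊓
        Ideal.span {x} :=
      ⟨by rw [smul_eq_mul, Ideal.mul_top]; exact ha, Ideal.mul_mem_right _ _
        (Ideal.mem_span_singleton_self x)⟩
    rw [hl (k + 1) (by omega)] at h2
    exact Ideal.mul_mono_right inf_le_right h2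
  obtain ⟨b, hb, hab⟩ := Ideal.mem_mul_span_singleton.mp h1
  have hab' : b = a := (mul_cancel_right_mem_nonZeroDivisors hreg).mp (by rw [hab, mul_comm])
  rw [← hab']
  exact Ideal.pow_le_pow_right (by omega) hb

end Superficial

end LocalMumford

theorem theorem4p1 {A : Type*} [CommRing A] [IsLocalRing A] [IsNoetherianRing A]
    (hdim : 2 ≤ ringKrullDim A) (hdepth : 0 < LocalMumford.depth A)
    (x : A) (hx : LocalMumford.IsSuperficial x) :
    ∃ m : ℕ,
      LocalMumford.regGr ((IsLocalRing.maximalIdeal A).map (Ideal.Quotient.mk (Ideal.span {x})))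
          = (((m : ℤ) : WithTop ℤ) : WithBot (WithTop ℤ)) ∧
      LocalMumford.regGr (IsLocalRing.maximalIdeal A) ≤
        (((m + LocalMumford.hilbertFn1
            ((IsLocalRing.maximalIdeal A).map (Ideal.Quotient.mk (Ideal.span {x}))) m : ℤ) :
          WithTop ℤ) : WithBot (WithTop ℤ)) := by
  set 𝔪 := IsLocalRing.maximalIdeal A
  set q := Ideal.Quotient.mk (Ideal.span {x})
  have hx𝔪 : x ∈ 𝔪 := hx.1
  have hle : Ideal.span {x} ≤ 𝔪 := (Ideal.span_singleton_le_iff_mem 𝔪).mpr hx𝔪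
  have hmax : (𝔪.map q).IsMaximal := by
    refine Ideal.IsMaximal.map_of_surjective_of_ker_le Ideal.Quotient.mk_surjective ?_
    rwa [Ideal.mk_ker]
  obtain ⟨m, hm, hexact⟩ := LocalMumford.exists_regGr_eq hmax.ne_top
  refine ⟨m, hm, ?_⟩
  have hreg := hx.mem_nonZeroDivisors hdepth
  obtain ⟨k₀, hk₀⟩ := hx.exists_colonPow_le hreg
  -- the images of generators of `𝔪` generate its image in `A / xA`
  let g : Fin (LocalMumford.numGens 𝔪) → A := fun i => LocalMumford.gens 𝔪 i
  have hg : 𝔪 = Ideal.span (Set.range g) := (LocalMumford.span_range_gens 𝔪).symm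
  have hb := hexact (fun i => ⟨q (g i), Ideal.mem_map_of_mem q (LocalMumford.gens 𝔪 i).2⟩) (by
    conv_rhs => rw [hg, Ideal.map_span, ← Set.range_comp]
    rfl)
  -- the modules of sections are taken in the localization at `x`
  have hinj : Function.Injective (algebraMap A (Localization.Away x)) :=
    IsLocalization.injective _ (Submonoid.powers_le.mpr hreg)
  have hH := LocalMumford.length_quotient_sup_le 𝔪 x (m + 1)
  rw [LocalMumford.length_quotient_pow_eq_hilbertFn1 (𝔪.map q)] at hH
  have hcolon := fun n hn => LocalMumford.colonPow_le_pow_of_ge (n := n) hx𝔪 hinj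
    (IsLocalization.Away.algebraMap_isUnit x) hg hb hk₀
    (LocalMumford.length_quotient_pow_ne_top 𝔪 (m + 1)) hH hn
  exact_mod_cast LocalMumford.regGr_le_of_grExact (N := m + LocalMumford.hilbertFn1 (𝔪.map q) m)
    fun ℓ hℓ => LocalMumford.grExact_of_quotient hx𝔪 hg (fun ℓ hℓ => hb ℓ (by omega)) hcolon hℓ
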